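/- Let $q\in C^1([0,\infty))$, $Q(y)=\int_0^y 2q(x)\,dx$ and $\Lambda(x)=\int_0^x e^{Q(y)}\,dy$, and let $L^*\varphi=\tfrac12\varphi''+(q\varphi)'$ on $[0,\infty)$. For $\lambda\in\mathbb R$ let $\varphi_\lambda$ be the solution of $L^*\varphi_\lambda=-\lambda\varphi_\lambda$ on $[0,\infty)$ with $\varphi_\lambda(0)=0$, $\varphi_\lambda'(0)=1$. For $b>0$ let $$\varrho_b(\lambda)=\sum_{l<\lambda,\ \varphi_l(b)=0}\Big(\int_0^b\varphi_l(x)^2e^{Q(x)}\,dx\Big)^{-1}$$ be the spectral function of $L^*$ on $[0,b]$ with Dirichlet conditions at both ends, and let $\varrho$ be the (left-continuous) spectral function of $L^*$ on $(0,\infty)$ with Dirichlet condition at $0$, that is, the limit of $\varrho_b$ as $b\to\infty$ at the continuity points, $\varrho(\lambda)=\sup_{t<\lambda}\limsup_{b\to\infty}\varrho_b(t)$. Assume hypothesis (H): (H1) $\Lambda(\infty)=\infty$, and (H2) $\int_0^\infty e^{Q(y)}\Big(\int_y^\infty e^{-Q(z)}\,dz\Big)dy=\infty$. Then $\varrho$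 has a smallest point of increase $\lambda_c$ (the bottom of the spectrum); it is also given by $$\lambda_c=\sup\{\lambda\in\mathbb R:\varphi_\lambda \text{ does not change sign on }(0,\infty)\};$$ and $\lambda_c>0$ if and only if $\delta<\infty$, where $$\delta=\sup_{x>0}\int_0^x e^{Q(y)}\,dy\int_x^\infty 2e^{-Q(y)}\,dy\in[0,\infty].$$ -/

import Mathlib

open Set Filter Topology MeasureTheory
open scoped ENNReal

noncomputable section

namespace QSD

/-- `Q(y) = ∫₀^y 2 q(x) dx`. -/
def Q (q : ℝ → ℝ) (y : ℝ) : ℝ := ∫ x in (0 : ℝ)..y, 2 * q x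

/-- The scale function `Λ(x) = ∫₀^x e^{Q(y)} dy`. -/
def scale (q : ℝ → ℝ) (x : ℝ) : ℝ := ∫ y in (0 : ℝ)..x, Real.exp (Q q y)

/-- `Λ(∞) = ∞`: absorption at `0` is certain. -/
def HypH1 (q : ℝ → ℝ) : Prop := Tendsto (scale q) atTop atTop

/-- `S = ∫₀^∞ e^{Q(y)} (∫_y^∞ e^{-Q(z)} dz) dy = ∞`. -/
def HypH2 (q : ℝ → ℝ) : Prop :=
  (∫⁻ y in Ioi (0 : ℝ), ENNReal.ofReal (Real.exp (Q q y)) *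
    ∫⁻ z in Ioi y, ENNReal.ofReal (Real.exp (-Q q z))) = ⊤

/-- Hypothesis (H): together the two conditions make `+∞` a natural boundary. -/
def HypH (q : ℝ → ℝ) : Prop := HypH1 q ∧ HypH2 q

/-- `δ = sup_{x > 0} ∫₀^x e^{Q(y)} dy ∫_x^∞ 2 e^{-Q(y)} dy`, a value in `[0, ∞]`. -/
def delta (q : ℝ → ℝ) : ℝ≥0∞ :=
  ⨆ (x : ℝ) (_ : 0 < x), ENNReal.ofReal (scale q x) *
    ∫⁻ y in Ioi x, ENNReal.ofReal (2 * Real.exp (-Q q y))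

/-- The formal adjoint `L* φ = (1/2) φ'' + (q φ)'` on the half line `[0, ∞)`
(one-sided derivatives at `0`). -/
def LStar (q φ : ℝ → ℝ) (x : ℝ) : ℝ :=
  (1 / 2) * derivWithin (derivWithin φ (Ici 0)) (Ici 0) x +
    derivWithin (fun y => q y * φ y) (Ici 0) x

/-- `φ` is a `C²` solution on `[0, ∞)` of `L* φ = -l φ`, `φ(0) = 0`, `φ'(0) = 1`. -/
def IsPhi (q : ℝ → ℝ) (l : ℝ) (φ : ℝ → ℝ) : Prop :=
  ContDiffOn ℝ 2 φ (Ici 0) ∧ (∀ x ∈ Ici (0 : ℝ), LStar q φ x = -l * φ x) ∧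
    φ 0 = 0 ∧ derivWithin φ (Ici 0) 0 = 1

/-- The solution `φ_l`. For `q ∈ C¹([0, ∞))` it exists and is unique on `[0, ∞)`; only its values
there are used. -/
def phi (q : ℝ → ℝ) (l : ℝ) : ℝ → ℝ := Classical.epsilon (IsPhi q l)

/-- `f` takes both a negative and a positive value on `(0, ∞)`. -/
def ChangesSign (f : ℝ → ℝ) : Prop := ∃ x > 0, ∃ y > 0, f x < 0 ∧ 0 < f y

/-- The left-continuous spectral function of the regular problem `L* φ = -l φ` on `[0, b]`,
`φ(0) = φ(b) = 0`, which is symmetric in `L²((0, b), e^{Q(x)} dx)`: the eigenvalues are the `l`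
with `φ_l(b) = 0`, and it jumps at each of them by the inverse squared norm of `φ_l`. -/
def spectralFunctionOn (q : ℝ → ℝ) (b l : ℝ) : ℝ≥0∞ :=
  ∑' k : {k : ℝ // phi q k b = 0 ∧ k < l},
    (∫⁻ x in Ioo 0 b, ENNReal.ofReal (phi q k x ^ 2 * Real.exp (Q q x)))⁻¹

/-- The left-continuous spectral function `ϱ` of `L*` on `(0, ∞)` with Dirichlet condition at `0`,
normalized by `ϱ(-∞) = 0` (Weyl's construction): the limit, as `b → ∞`, of the spectral functions
of the problems on `[0, b]`. They converge at all continuity points of `ϱ`, hence `ϱ(l)` is the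
supremum over `t < l` of the upper limits at `t`. (When `∞` is a natural boundary it is of
limit point type, and no boundary condition at `∞` intervenes.) -/
def spectralFunction (q : ℝ → ℝ) (l : ℝ) : ℝ≥0∞ :=
  ⨆ (t : ℝ) (_ : t < l), limsup (fun b : ℝ => spectralFunctionOn q b t) atTop

/-- `l` is a point of increase of `F`. -/
def IsPointOfIncrease (F : ℝ → ℝ≥0∞) (l : ℝ) : Prop :=
  ∀ ε > 0, F (l - ε) < F (l + ε)

/-- `λ_c`, the smallest point of increase of the spectral function of `L*`. -/
def lambdaC (q : ℝ → ℝ) : ℝ := sInf {l | IsPointOfIncrease (spectralFunction q) l}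

end QSD

end

open scoped NNReal

noncomputable section

namespace QSD

/-! With a = e^Q and c = 2e^{-Q}, the substitution φ = e^{-Q} u turns L*φ = -lφ into the system u' =
a v, v' = -l c u. Let m be the supremum of the l for which u_l has no zero on (0, ∞). By Sturm
comparison every l < m has this property, so no problem on [0, b] has an eigenvalue below m, and ϱ
vanishes up to and including m.

The main point is that ϱ > 0 to the right of m, that is, that the spectral mass does not disappear
as b → ∞ (`exists_spectral_lower_bound`). Let m < l < s and u_l(z) = 0. The Prüfer angle attaches to
each zero of u_s in (0, b) its own eigenvalue κ < s. The energy form E(h) = ∫ (a k² - s c h²), where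
h' = a k, is negative definite on the span of these eigenfunctions, and by Jacobi's inequality it is
nonnegative on functions vanishing at 0, at b and at the zeros of u_s. Hence a combination ψ of the
eigenfunctions can be made to agree, at those zeros, with u_l cut off at z. Jacobi's inequality for
the difference bounds (s - l)∫₀^z c u_l² by a constant independent of b times the sum of the inverse
squared norms of the eigenfunctions.

Positivity of m is Muckenhoupt's criterion: `ne_zero_of_mul_le` keeps small positive l free of zeros
when δ < ∞, and `mul_integral_le` bounds δ by 1/l when u_l has no zeros and l > 0. -/

/-! ### Global solutions and the Prüfer angle -/

/-- A scalar differential equation whose right-hand side is, locally uniformly in time, bounded and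
Lipschitz in space has a global solution. -/
lemma exists_global_integralCurve {f : ℝ → ℝ → ℝ} (hf : ∀ x, Continuous fun t => f t x)
    (hb : ∀ T : ℝ, ∃ K L : ℝ≥0, ∀ t ∈ Icc (-T) T, LipschitzWith K (f t) ∧ ∀ x, ‖f t x‖ ≤ L) :
    ∃ θ : ℝ → ℝ, θ 0 = 0 ∧ ∀ t, HasDerivAt θ (f t (θ t)) t := by
  have hloc : ∀ n : ℕ, ∃ α : ℝ → ℝ, α 0 = 0 ∧
      ∀ t ∈ Ioo (-((n : ℝ) + 1)) (n + 1), HasDerivAt α (f t (α t)) t := by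
    intro n
    obtain ⟨K, L, hKL⟩ := hb (n + 1)
    have h0 : (0 : ℝ) ∈ Icc (-((n : ℝ) + 1)) (n + 1) := ⟨by linarith [n.cast_nonneg (α := ℝ)],
      by positivity⟩
    -- The radius `L * (n + 1)` is the farthest a curve of speed at most `L` can travel, so the
    -- local solution fills the whole interval.
    have hpl : IsPicardLindelof f (⟨0, h0⟩ : Icc (-((n : ℝ) + 1)) (n + 1)) (0 : ℝ)
        (L * (n + 1)) 0 L K := by
      refine ⟨fun t ht => (hKL t ht).1.lipschitzOnWith, fun x _ => (hf x).continuousOn,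
        fun t ht x _ => (hKL t ht).2 x, ?_⟩
      simp
    obtain ⟨α, hα0, hα⟩ := hpl.exists_eq_forall_mem_Icc_hasDerivWithinAt₀
    exact ⟨α, hα0, fun t ht => (hα t (Ioo_subset_Icc_self ht)).hasDerivAt (Icc_mem_nhds ht.1 ht.2)⟩
  choose α hα0 hα using hloc
  have hagree : ∀ m n : ℕ, ∀ t : ℝ, m ≤ n → |t| < m + 1 → α m t = α n t := by
    intro m n t hmn ht
    obtain ⟨K, L, hKL⟩ := hb (m + 1)
    have hmn' : (m : ℝ) ≤ n := by exact_mod_cast hmn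
    refine ODE_solution_unique_of_mem_Ioo (v := f) (s := fun _ => univ) (K := K)
      (a := -((m : ℝ) + 1)) (b := m + 1) (t₀ := 0)
      (fun s hs => (hKL s (Ioo_subset_Icc_self hs)).1.lipschitzOnWith)
      ⟨by linarith [m.cast_nonneg (α := ℝ)], by positivity⟩ (fun s hs => ⟨hα m s hs, trivial⟩)
      (fun s hs => ⟨hα n s ⟨by linarith [hs.1], by linarith [hs.2]⟩, trivial⟩)
      (by rw [hα0, hα0]) (abs_lt.1 ht)
  have hagree' : ∀ m n : ℕ, ∀ t : ℝ, |t| < m + 1 → |t| < n + 1 → α m t = α n t := by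
    intro m n t hm hn
    rcases le_total m n with h | h
    · exact hagree m n t h hm
    · exact (hagree n m t h hn).symm
  -- The solution with index n lives on |t| < n + 1, so the index ⌈|t|⌉ leaves room for a
  -- neighbourhood of t, on which all admissible indices agree.
  refine ⟨fun t => α ⌈|t|⌉₊ t, by simp [hα0], fun t => ?_⟩
  have ht : |t| < (⌈|t|⌉₊ : ℝ) + 1 := (Nat.le_ceil _).trans_lt (lt_add_one _)
  refine (hα ⌈|t|⌉₊ t (abs_lt.1 ht)).congr_of_eventuallyEq ?_
  filter_upwards [continuous_abs.continuousAt.eventually_lt_const ht] with y hy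
  exact hagree' _ _ y ((Nat.le_ceil _).trans_lt (lt_add_one _)) hy

/-- The right-hand side of the equation satisfied by the Prüfer angle. -/
def pruferField (A B θ : ℝ) : ℝ := A * Real.cos θ ^ 2 + B * Real.sin θ ^ 2

lemma pruferField_lipschitz {A B C : ℝ} {K : ℝ≥0} (hA : |A| ≤ C) (hB : |B| ≤ C)
    (hK : 2 * C ≤ K) : LipschitzWith K (pruferField A B) := by
  have hd : ∀ x, HasDerivAt (pruferField A B) ((B - A) * Real.sin (2 * x)) x := by
    intro x
    have h1 := ((Real.hasDerivAt_cos x).pow 2).const_mul A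
    have h2 := ((Real.hasDerivAt_sin x).pow 2).const_mul B
    convert! h1.add h2 using 1
    rw [Real.sin_two_mul]; push_cast; ring
  refine lipschitzWith_of_nnnorm_deriv_le (fun x => (hd x).differentiableAt) fun x => ?_
  rw [(hd x).deriv, ← NNReal.coe_le_coe, coe_nnnorm, norm_mul, Real.norm_eq_abs, Real.norm_eq_abs]
  have h1 := Real.abs_sin_le_one (2 * x)
  have h2 : |B - A| ≤ 2 * C := (abs_sub _ _).trans (by linarith)
  nlinarith [abs_nonneg (B - A), abs_nonneg (Real.sin (2 * x))]

lemma abs_pruferField_le {A B C : ℝ} (hA : |A| ≤ C) (hB : |B| ≤ C) (x : ℝ) :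
    |pruferField A B x| ≤ C := by
  rw [abs_le] at hA hB ⊢
  have h := Real.sin_sq_add_cos_sq x
  unfold pruferField
  have := sq_nonneg (Real.sin x)
  have := sq_nonneg (Real.cos x)
  constructor <;> nlinarith

lemma exists_abs_le_Icc {f : ℝ → ℝ} (hf : Continuous f) (α β : ℝ) :
    ∃ C : ℝ, 0 ≤ C ∧ ∀ x ∈ Icc α β, |f x| ≤ C := by
  obtain ⟨C, hC⟩ := isCompact_Icc.exists_bound_of_continuousOn (s := Icc α β) hf.continuousOn
  exact ⟨max C 0, le_max_right _ _, fun x hx => (hC x hx).trans (le_max_left _ _)⟩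

lemma exists_prufer {a c : ℝ → ℝ} (ha : Continuous a) (hc : Continuous c) (l : ℝ) :
    ∃ θ : ℝ → ℝ, θ 0 = 0 ∧ ∀ x, HasDerivAt θ (pruferField (a x) (l * c x) (θ x)) x := by
  refine exists_global_integralCurve (f := fun t x => pruferField (a t) (l * c t) x)
    (fun x => by unfold pruferField; fun_prop) fun T => ?_
  obtain ⟨C₁, h1, hC₁⟩ := exists_abs_le_Icc ha (-T) T
  obtain ⟨C₂, h2, hC₂⟩ := exists_abs_le_Icc (f := fun t => l * c t) (by fun_prop) (-T) T
  refine ⟨⟨2 * (C₁ + C₂), by positivity⟩, ⟨C₁ + C₂, by positivity⟩, fun t ht => ⟨?_, fun x => ?_⟩⟩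
  · exact pruferField_lipschitz (C := C₁ + C₂) ((hC₁ t ht).trans (by linarith))
      ((hC₂ t ht).trans (by linarith)) le_rfl
  · exact abs_pruferField_le (C := C₁ + C₂) ((hC₁ t ht).trans (by linarith))
      ((hC₂ t ht).trans (by linarith)) x

/-- The Prüfer angle depends continuously on the spectral parameter. -/
lemma continuous_prufer {a c : ℝ → ℝ} (ha : Continuous a) (hc : Continuous c) {θ : ℝ → ℝ → ℝ}
    (hθ0 : ∀ l, θ l 0 = 0)
    (hθ : ∀ l x, HasDerivAt (θ l) (pruferField (a x) (l * c x) (θ l x)) x) {b : ℝ} (hb : 0 ≤ b) :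
    Continuous fun l => θ l b := by
  obtain ⟨C₁, h1, hC₁⟩ := exists_abs_le_Icc ha 0 b
  obtain ⟨C₂, h2, hC₂⟩ := exists_abs_le_Icc hc 0 b
  rw [continuous_iff_continuousAt]
  intro l
  -- Grönwall: θ_m solves the equation with parameter l up to an error of |m - l| C₂, because the
  -- parameter enters only through l c sin².
  have key : ∀ m, dist (θ m b) (θ l b) ≤
      gronwallBound 0 (2 * (C₁ + |l| * C₂)) (|m - l| * C₂) (b - 0) := by
    intro m
    have hK : 0 ≤ 2 * (C₁ + |l| * C₂) := by positivity
    have := dist_le_of_approx_trajectories_ODE_of_mem (f := θ m) (g := θ l) (a := 0) (b := b)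
      (v := fun t x => pruferField (a t) (l * c t) x) (s := fun _ => univ)
      (f' := fun x => pruferField (a x) (m * c x) (θ m x))
      (g' := fun x => pruferField (a x) (l * c x) (θ l x)) (εf := |m - l| * C₂) (εg := 0) (δ := 0)
      (K := ⟨2 * (C₁ + |l| * C₂), hK⟩)
      (fun t ht => (pruferField_lipschitz (C := C₁ + |l| * C₂)
        ((hC₁ t (Ico_subset_Icc_self ht)).trans (le_add_of_nonneg_right (by positivity))) (by
          rw [abs_mul]
          have := hC₂ t (Ico_subset_Icc_self ht)
          nlinarith [abs_nonneg l]) le_rfl).lipschitzOnWith)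
      (HasDerivAt.continuousOn fun x _ => hθ m x) (fun t _ => (hθ m t).hasDerivWithinAt)
      (fun t ht => by
        rw [Real.dist_eq]
        have e : pruferField (a t) (m * c t) (θ m t) - pruferField (a t) (l * c t) (θ m t) =
          (m - l) * (c t * Real.sin (θ m t) ^ 2) := by unfold pruferField; ring
        rw [e, abs_mul, abs_mul, abs_pow]
        have hct := hC₂ t (Ico_subset_Icc_self ht)
        have hs : |Real.sin (θ m t)| ^ 2 ≤ 1 := pow_le_one₀ (abs_nonneg _) (Real.abs_sin_le_one _)
        refine mul_le_mul_of_nonneg_left ?_ (abs_nonneg _)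
        nlinarith [abs_nonneg (c t)])
      (fun t _ => trivial)
      (HasDerivAt.continuousOn fun x _ => hθ l x) (fun t _ => (hθ l t).hasDerivWithinAt)
      (fun t _ => by simp) (fun t _ => trivial) (by simp [hθ0]) b ⟨hb, le_rfl⟩
    simpa using! this
  rw [ContinuousAt, tendsto_iff_dist_tendsto_zero]
  refine squeeze_zero (fun _ => dist_nonneg) key ?_
  have hcont : Continuous fun m : ℝ =>
      gronwallBound 0 (2 * (C₁ + |l| * C₂)) (|m - l| * C₂) (b - 0) :=
    (gronwallBound_continuous_ε 0 _ (b - 0)).comp (by fun_prop)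
  have := hcont.tendsto l
  simpa [gronwallBound_ε0_δ0] using this

/-! ### The first order system and its polar form -/

/-- `(u, v)` solves the first order system `u' = a v`, `v' = -l c u`, with `u(0) = 0`,
`v(0) = 1`. -/
structure IsSol (a c : ℝ → ℝ) (l : ℝ) (u v : ℝ → ℝ) : Prop where
  hasDerivAt_fst : ∀ x, HasDerivAt u (a x * v x) x
  hasDerivAt_snd : ∀ x, HasDerivAt v (-l * c x * u x) x
  fst_zero : u 0 = 0
  snd_zero : v 0 = 1

namespace IsSol

variable {a c : ℝ → ℝ} {l : ℝ} {u v : ℝ → ℝ}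

lemma continuous_fst (h : IsSol a c l u v) : Continuous u :=
  continuous_iff_continuousAt.2 fun x => (h.hasDerivAt_fst x).continuousAt

lemma continuous_snd (h : IsSol a c l u v) : Continuous v :=
  continuous_iff_continuousAt.2 fun x => (h.hasDerivAt_snd x).continuousAt

end IsSol

/-- Solutions in polar form: `u = r sin θ`, `v = r cos θ`, with the Prüfer angle `θ`. -/
lemma exists_polar_solution {a c : ℝ → ℝ} (ha : Continuous a) (hc : Continuous c) (l : ℝ) :
    ∃ θ r : ℝ → ℝ, θ 0 = 0 ∧ (∀ x, HasDerivAt θ (pruferField (a x) (l * c x) (θ x)) x) ∧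
      (∀ x, 0 < r x) ∧ (∀ x, 0 ≤ x → r x ≤ Real.exp (∫ t in (0 : ℝ)..x, |a t| + |l| * |c t|)) ∧
      IsSol a c l (fun x => r x * Real.sin (θ x)) (fun x => r x * Real.cos (θ x)) := by
  obtain ⟨θ, h0, hθ⟩ := exists_prufer ha hc l
  have hθc : Continuous θ := continuous_iff_continuousAt.2 fun x => (hθ x).continuousAt
  have hg : Continuous fun t => (a t - l * c t) * Real.sin (θ t) * Real.cos (θ t) := by fun_prop
  -- The radial Prüfer equation is r' = g r, so r is the exponential of the integral of g.
  set g := fun t => (a t - l * c t) * Real.sin (θ t) * Real.cos (θ t) with hgdef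
  have hr : ∀ x, HasDerivAt (fun x => Real.exp (∫ t in (0 : ℝ)..x, g t))
      (Real.exp (∫ t in (0 : ℝ)..x, g t) * g x) x := fun x =>
    (intervalIntegral.integral_hasDerivAt_right (hg.intervalIntegrable _ _)
      hg.aestronglyMeasurable.stronglyMeasurableAtFilter hg.continuousAt).exp
  refine ⟨θ, fun x => Real.exp (∫ t in (0 : ℝ)..x, g t), h0, hθ, fun x => Real.exp_pos _, ?_, ?_⟩
  · intro x hx
    refine Real.exp_le_exp.2 (intervalIntegral.integral_mono_on hx (hg.intervalIntegrable _ _)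
      (Continuous.intervalIntegrable (by fun_prop) _ _) fun t _ => ?_)
    refine (le_abs_self _).trans ?_
    rw [hgdef]
    simp only [abs_mul]
    have h1 := Real.abs_sin_le_one (θ t)
    have h2 := Real.abs_cos_le_one (θ t)
    have h3 : |a t - l * c t| ≤ |a t| + |l| * |c t| := by
      rw [← abs_mul]; exact abs_sub _ _
    have h4 : |Real.sin (θ t)| * |Real.cos (θ t)| ≤ 1 := mul_le_one₀ h1 (abs_nonneg _) h2
    rw [mul_assoc]
    nlinarith [abs_nonneg (a t - l * c t)]
  · refine ⟨fun x => ?_, fun x => ?_, by simp [h0], by simp [h0]⟩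
    · convert! (hr x).mul (hθ x).sin using 1
      simp only [hgdef, pruferField]
      linear_combination (-(a x * Real.exp (∫ t in (0 : ℝ)..x, g t) * Real.cos (θ x))) *
        Real.sin_sq_add_cos_sq (θ x)
    · convert! (hr x).mul (hθ x).cos using 1
      simp only [hgdef, pruferField]
      linear_combination (l * c x * Real.exp (∫ t in (0 : ℝ)..x, g t) * Real.sin (θ x)) *
        Real.sin_sq_add_cos_sq (θ x)

/-! ### Energy forms, Jacobi's inequality and orthogonality -/

section

variable {a c : ℝ → ℝ}

/-- `h` is a continuously differentiable function with `h' = a k`. -/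
structure TestPair (a h k : ℝ → ℝ) : Prop where
  hasDerivAt : ∀ x, HasDerivAt h (a x * k x) x
  continuous_snd : Continuous k

lemma TestPair.continuous_fst {h k : ℝ → ℝ} (H : TestPair a h k) : Continuous h :=
  continuous_iff_continuousAt.2 fun x => (H.hasDerivAt x).continuousAt

lemma IsSol.testPair {l : ℝ} {u v : ℝ → ℝ} (H : IsSol a c l u v) : TestPair a u v :=
  ⟨H.hasDerivAt_fst, H.continuous_snd⟩

lemma TestPair.sub {h k h' k' : ℝ → ℝ} (H : TestPair a h k) (H' : TestPair a h' k') :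
    TestPair a (fun x => h x - h' x) (fun x => k x - k' x) :=
  ⟨fun x => by simpa only [mul_sub] using (H.hasDerivAt x).fun_sub (H'.hasDerivAt x),
    H.continuous_snd.sub H'.continuous_snd⟩

lemma TestPair.sum {ι : Type*} [Fintype ι] {h k : ι → ℝ → ℝ} (H : ∀ i, TestPair a (h i) (k i))
    (w : ι → ℝ) : TestPair a (fun x => ∑ i, h i x * w i) (fun x => ∑ i, k i x * w i) := by
  refine ⟨fun x => ?_, continuous_finsetSum _ fun i _ => (H i).continuous_snd.mul_const _⟩
  have := HasDerivAt.fun_sum (u := Finset.univ) fun i _ => ((H i).hasDerivAt x).mul_const (w i)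
  simpa only [Finset.mul_sum, mul_assoc] using this

/-- Integration by parts against a solution. -/
lemma IsSol.integral_form (ha : Continuous a) (hc : Continuous c) {l : ℝ} {u v h k : ℝ → ℝ}
    (H : IsSol a c l u v) (T : TestPair a h k) (α β : ℝ) :
    ∫ x in α..β, (a x * k x * v x - l * c x * h x * u x) = h β * v β - h α * v α := by
  have h1 := T.continuous_fst
  have h2 := T.continuous_snd
  have h3 := H.continuous_fst
  have h4 := H.continuous_snd
  refine intervalIntegral.integral_eq_sub_of_hasDerivAt (f := fun x => h x * v x) (fun x _ => ?_)
    (Continuous.intervalIntegrable (by fun_prop) _ _)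
  convert! (T.hasDerivAt x).mul (H.hasDerivAt_snd x) using 1
  ring

/-- A simple zero of g is cancelled by the double zero of h², and division by zero returns 0, which
is the correct limit. This lets h² v / u be differentiated across the zeros of u. -/
lemma hasDerivAt_sq_div {h g w : ℝ → ℝ} {h' g' x : ℝ} (hh : HasDerivAt h h' x)
    (hg : HasDerivAt g g' x) (hw : ContinuousAt w x) (hx : h x = 0) (gx : g x = 0) (hg' : g' ≠ 0) :
    HasDerivAt (fun y => h y ^ 2 * w y / g y) (h' ^ 2 * w x / g') x := by
  rw [hasDerivAt_iff_tendsto_slope] at hh hg ⊢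
  have hw' : Tendsto w (𝓝[≠] x) (𝓝 (w x)) := hw.tendsto.mono_left nhdsWithin_le_nhds
  refine (((hh.pow 2).mul hw').div hg hg').congr' ?_
  filter_upwards [self_mem_nhdsWithin] with y hy
  have hy' : y - x ≠ 0 := sub_ne_zero.2 hy
  simp only [slope_def_field, hx, gx, sub_zero]
  by_cases hgy : g y = 0
  · simp [slope_def_field, gx, hgy]
  · simp [Pi.div_apply, slope_def_field, gx]
    field_simp

/-- Jacobi's inequality: a solution with parameter `s` bounds the energy from below, for all test
functions that vanish at its zeros. -/
lemma IsSol.jacobi (ha : Continuous a) (hc : Continuous c) (ha0 : ∀ x, 0 < a x) {s : ℝ}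
    {u v h k : ℝ → ℝ} (H : IsSol a c s u v) (hne : ∀ x, u x = 0 → v x ≠ 0) (T : TestPair a h k)
    {α β : ℝ} (hαβ : α ≤ β) (hz : ∀ x ∈ Icc α β, u x = 0 → h x = 0) :
    h β ^ 2 * v β / u β - h α ^ 2 * v α / u α ≤
      ∫ x in α..β, (a x * k x ^ 2 - s * c x * h x ^ 2) := by
  have h1 := T.continuous_fst
  have h2 := T.continuous_snd
  -- Riccati identity: off the zeros of u, the derivative of h² v / u is the energy density minus a
  -- perfect square.
  have hd : ∀ x ∈ Icc α β, HasDerivAt (fun y => h y ^ 2 * v y / u y)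
      (if u x = 0 then a x * k x ^ 2 else
        a x * k x ^ 2 - s * c x * h x ^ 2 - a x * (k x - h x * v x / u x) ^ 2) x := by
    intro x hx
    split_ifs with hu
    · have hax := (ha0 x).ne'
      have hv := hne x hu
      convert! hasDerivAt_sq_div (T.hasDerivAt x) (H.hasDerivAt_fst x)
        (H.hasDerivAt_snd x).continuousAt (hz x hx hu) hu (mul_ne_zero hax hv) using 1
      field_simp
    · convert! (((T.hasDerivAt x).pow 2).mul (H.hasDerivAt_snd x)).div (H.hasDerivAt_fst x) hu
        using 1
      simp only [Pi.mul_apply, Pi.pow_apply]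
      field_simp
      push_cast
      ring
  refine intervalIntegral.sub_le_integral_of_hasDeriv_right_of_le
    (g := fun y => h y ^ 2 * v y / u y) hαβ
    (HasDerivAt.continuousOn hd) (fun x hx => (hd x (Ioo_subset_Icc_self hx)).hasDerivWithinAt)
    (Continuous.integrableOn_Icc (by fun_prop)) fun x hx => ?_
  split_ifs with hu
  · simp [hz x (Ioo_subset_Icc_self hx) hu]
  · have := mul_nonneg (ha0 x).le (sq_nonneg (k x - h x * v x / u x))
    linarith

/-- The energy form with parameter `s` against a linear combination of solutions. -/
lemma integral_form_sum (ha : Continuous a) (hc : Continuous c) {ι : Type*} [Fintype ι]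
    {κ : ι → ℝ} {u v : ι → ℝ → ℝ} (H : ∀ i, IsSol a c (κ i) (u i) (v i)) (w : ι → ℝ) (s : ℝ)
    {h k : ℝ → ℝ} (T : TestPair a h k) {α β : ℝ} (hα : h α = 0) (hβ : h β = 0) :
    ∫ x in α..β, (a x * k x * (∑ i, v i x * w i) - s * c x * h x * (∑ i, u i x * w i)) =
      ∑ i, w i * (κ i - s) * ∫ x in α..β, c x * h x * u i x := by
  have h1 := T.continuous_fst
  have h2 := T.continuous_snd
  have h3 := fun i => (H i).continuous_fst
  have h4 := fun i => (H i).continuous_snd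
  -- Each term splits into the density with parameter κ_i, which integrates to a vanishing boundary
  -- term, and a multiple κ_i - s of the mass.
  have e : ∀ x, a x * k x * (∑ i, v i x * w i) - s * c x * h x * (∑ i, u i x * w i) =
      ∑ i, (w i * (a x * k x * v i x - κ i * c x * h x * u i x) +
        w i * (κ i - s) * (c x * h x * u i x)) := by
    intro x
    rw [Finset.mul_sum, Finset.mul_sum, ← Finset.sum_sub_distrib]
    exact Finset.sum_congr rfl fun i _ => by ring
  simp_rw [e]
  rw [intervalIntegral.integral_finsetSum
    (fun i _ => Continuous.intervalIntegrable (by fun_prop) _ _)]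
  refine Finset.sum_congr rfl fun i _ => ?_
  rw [intervalIntegral.integral_add (Continuous.intervalIntegrable (by fun_prop) _ _)
    (Continuous.intervalIntegrable (by fun_prop) _ _), intervalIntegral.integral_const_mul,
    intervalIntegral.integral_const_mul, (H i).integral_form ha hc T, hα, hβ]
  ring

/-- Eigenfunctions to different eigenvalues are orthogonal. -/
lemma IsSol.orthogonal (ha : Continuous a) (hc : Continuous c) {l m : ℝ} {u v u' v' : ℝ → ℝ}
    (H : IsSol a c l u v) (H' : IsSol a c m u' v') (hlm : l ≠ m) {b : ℝ} (hb : u b = 0)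
    (hb' : u' b = 0) : ∫ x in (0 : ℝ)..b, c x * u x * u' x = 0 := by
  have h1 := H.continuous_fst
  have h2 := H.continuous_snd
  have h3 := H'.continuous_fst
  have h4 := H'.continuous_snd
  have e1 := H.integral_form ha hc H'.testPair 0 b
  have e2 := H'.integral_form ha hc H.testPair 0 b
  rw [hb', H'.fst_zero] at e1
  rw [hb, H.fst_zero] at e2
  have e3 : ∫ x in (0 : ℝ)..b, ((m - l) * (c x * u x * u' x)) = 0 := by
    have : ∀ x, (m - l) * (c x * u x * u' x) = (a x * v' x * v x - l * c x * u' x * u x) -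
      (a x * v x * v' x - m * c x * u x * u' x) := fun x => by ring
    simp_rw [this]
    rw [intervalIntegral.integral_sub (Continuous.intervalIntegrable (by fun_prop) _ _)
      (Continuous.intervalIntegrable (by fun_prop) _ _), e1, e2]
    ring
  rw [intervalIntegral.integral_const_mul] at e3
  exact (mul_eq_zero.1 e3).resolve_left (sub_ne_zero.2 hlm.symm)

lemma IsSol.energy_eq (ha : Continuous a) (hc : Continuous c) {l : ℝ} {u v : ℝ → ℝ}
    (H : IsSol a c l u v) (s : ℝ) {b : ℝ} (hb : u b = 0) :
    ∫ x in (0 : ℝ)..b, (a x * v x ^ 2 - s * c x * u x ^ 2) =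
      (l - s) * ∫ x in (0 : ℝ)..b, c x * u x ^ 2 := by
  have := integral_form_sum ha hc (ι := Unit) (fun _ => H) (fun _ => 1) s H.testPair
    H.fst_zero hb
  simpa [mul_assoc, sq] using this

/-- The squared norm of a solution is positive. -/
lemma IsSol.norm_pos (hc : Continuous c) (hc0 : ∀ x, 0 < c x) (ha0 : ∀ x, 0 < a x) {l : ℝ}
    {u v : ℝ → ℝ} (H : IsSol a c l u v) {b : ℝ} (hb : 0 < b) :
    0 < ∫ x in (0 : ℝ)..b, c x * u x ^ 2 := by
  have h1 := H.continuous_fst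
  have hd := H.hasDerivAt_fst 0
  rw [H.snd_zero, mul_one] at hd
  have hev := hd.eventually_ne (c := 0) (ha0 0).ne'
  obtain ⟨x, hx, hxu⟩ : ∃ x ∈ Ioo 0 b, u x ≠ 0 := by
    have h2 : ∀ᶠ x in 𝓝[>] (0 : ℝ), u x ≠ 0 :=
      hev.filter_mono (nhdsWithin_mono _ fun x hx => ne_of_gt hx)
    obtain ⟨x, hx1, hx2⟩ := (h2.and (Ioo_mem_nhdsGT hb)).exists
    exact ⟨x, hx2, hx1⟩
  refine intervalIntegral.integral_pos hb (Continuous.continuousOn (by fun_prop))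
    (fun y _ => mul_nonneg (hc0 y).le (sq_nonneg _)) ⟨x, Ioo_subset_Icc_self hx, ?_⟩
  have := hc0 x
  positivity

end

/-! ### Eigenvalues on [0, b] and the uniform spectral lower bound -/

section

variable {a c : ℝ → ℝ} {θ U V : ℝ → ℝ → ℝ}

/-- The solutions `(U l, V l)` for all parameters `l`, with their Prüfer angles `θ l`. -/
structure SolFamily (a c : ℝ → ℝ) (θ U V : ℝ → ℝ → ℝ) : Prop where
  theta_zero : ∀ l, θ l 0 = 0
  hasDerivAt_theta : ∀ l x, HasDerivAt (θ l) (pruferField (a x) (l * c x) (θ l x)) x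
  isSol : ∀ l, IsSol a c l (U l) (V l)
  eq_zero_iff : ∀ l x, U l x = 0 ↔ Real.sin (θ l x) = 0
  snd_ne_zero : ∀ l x, U l x = 0 → V l x ≠ 0
  abs_le : ∀ l x, 0 ≤ x → |U l x| ≤ Real.exp (∫ t in (0 : ℝ)..x, |a t| + |l| * |c t|)

lemma exists_solFamily (ha : Continuous a) (hc : Continuous c) :
    ∃ θ U V : ℝ → ℝ → ℝ, SolFamily a c θ U V := by
  choose θ r h0 hθ hr hrle hsol using exists_polar_solution ha hc
  refine ⟨θ, fun l x => r l x * Real.sin (θ l x), fun l x => r l x * Real.cos (θ l x), h0, hθ,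
    hsol, fun l x => by simp [(hr l x).ne'], fun l x hx => ?_, fun l x hx => ?_⟩
  · have hs : Real.sin (θ l x) = 0 := by simpa [(hr l x).ne'] using hx
    refine mul_ne_zero (hr l x).ne' fun hcos => ?_
    have := Real.sin_sq_add_cos_sq (θ l x)
    simp [hs, hcos] at this
  · rw [abs_mul, abs_of_pos (hr l x)]
    exact (mul_le_of_le_one_right (hr l x).le (Real.abs_sin_le_one _)).trans (hrle l x hx)

namespace SolFamily

lemma continuous_theta (F : SolFamily a c θ U V) (l : ℝ) : Continuous (θ l) :=
  continuous_iff_continuousAt.2 fun x => (F.hasDerivAt_theta l x).continuousAt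

/-- For s > 0 the Prüfer field is a combination of cos² and sin² with positive coefficients, so it
never vanishes. -/
lemma strictMono_theta (F : SolFamily a c θ U V) (ha0 : ∀ x, 0 < a x) (hc0 : ∀ x, 0 < c x) {s : ℝ}
    (hs : 0 < s) : StrictMono (θ s) := by
  refine strictMono_of_hasDerivAt_pos (F.hasDerivAt_theta s) fun x => ?_
  have h1 := ha0 x
  have h2 := mul_pos hs (hc0 x)
  have h3 := Real.sin_sq_add_cos_sq (θ s x)
  have h4 := sq_nonneg (Real.sin (θ s x))
  have h5 := sq_nonneg (Real.cos (θ s x))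
  unfold pruferField
  rcases h5.eq_or_lt with h | h
  · have : Real.sin (θ s x) ^ 2 = 1 := by linarith
    rw [← h, this]; linarith
  · have := mul_pos h1 h
    have := mul_nonneg h2.le h4
    linarith

/-- At parameter 0 the component v is constantly 1, so u is the scale function. -/
lemma pos_of_parameter_zero (F : SolFamily a c θ U V) (ha0 : ∀ x, 0 < a x) {x : ℝ}
    (hx : 0 < x) : 0 < U 0 x := by
  have hV : ∀ x, V 0 x = 1 := by
    intro x
    rw [← (F.isSol 0).snd_zero]
    exact is_const_of_deriv_eq_zero
      (fun x => ((F.isSol 0).hasDerivAt_snd x).differentiableAt)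
      (fun x => by rw [((F.isSol 0).hasDerivAt_snd x).deriv]; ring) x 0
  have hm : StrictMono (U 0) := strictMono_of_hasDerivAt_pos (F.isSol 0).hasDerivAt_fst
    fun x => by rw [hV, mul_one]; exact ha0 x
  simpa [(F.isSol 0).fst_zero] using hm hx

lemma theta_parameter_zero_lt_pi (F : SolFamily a c θ U V) (ha0 : ∀ x, 0 < a x) {b : ℝ}
    (hb : 0 < b) : θ 0 b < Real.pi := by
  by_contra! h
  obtain ⟨x, hx, hxθ⟩ := intermediate_value_Icc hb.le (F.continuous_theta 0).continuousOn
    (show Real.pi ∈ Icc (θ 0 0) (θ 0 b) by rw [F.theta_zero]; exact ⟨Real.pi_pos.le, h⟩)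
  have hx0 : 0 < x := by
    refine lt_of_le_of_ne hx.1 fun h0 => ?_
    rw [← h0, F.theta_zero] at hxθ
    exact Real.pi_pos.ne hxθ
  exact (F.pos_of_parameter_zero ha0 hx0).ne' ((F.eq_zero_iff 0 x).2 (by rw [hxθ, Real.sin_pi]))

/-- The zeros in `(0, b)` of the solution with parameter `s` are finite in number, and each of them
yields an eigenvalue of the problem on `[0, b]` that is smaller than `s`. -/
lemma exists_eigenvalues (F : SolFamily a c θ U V) (ha : Continuous a) (hc : Continuous c)
    (ha0 : ∀ x, 0 < a x) (hc0 : ∀ x, 0 < c x) {s b : ℝ} (hs : 0 < s) (hb : 0 < b) :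
    {x | x ∈ Ioo 0 b ∧ U s x = 0}.Finite ∧ ∃ κ : ℝ → ℝ, InjOn κ {x | x ∈ Ioo 0 b ∧ U s x = 0} ∧
      ∀ x ∈ {x | x ∈ Ioo 0 b ∧ U s x = 0}, κ x ∈ Ioo 0 s ∧ U (κ x) b = 0 := by
  set Z := {x | x ∈ Ioo 0 b ∧ U s x = 0}
  have hmono := F.strictMono_theta ha0 hc0 hs
  have hint : ∀ x ∈ Z, ∃ m : ℤ, (m : ℝ) * Real.pi = θ s x := fun x hx =>
    Real.sin_eq_zero_iff.1 ((F.eq_zero_iff s x).1 hx.2)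
  have hpos : ∀ x ∈ Z, 0 < θ s x := fun x hx => by
    have := hmono hx.1.1
    rwa [F.theta_zero] at this
  have hpi : ∀ x ∈ Z, Real.pi ≤ θ s x := by
    intro x hx
    obtain ⟨m, hm⟩ := hint x hx
    have h1 := hpos x hx
    rw [← hm] at h1 ⊢
    have h2 : (0 : ℝ) < m := pos_of_mul_pos_left h1 Real.pi_pos.le
    have h2' : 0 < m := by exact_mod_cast h2
    have h3 : (1 : ℝ) ≤ m := by exact_mod_cast h2'
    nlinarith [Real.pi_pos]
  constructor
  -- At the zeros θ / π is an integer, and these integers are distinct and bounded by θ(b) / π.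
  · refine Set.Finite.of_injOn (f := fun x => ⌊θ s x / Real.pi⌋)
      (t := Icc 0 ⌊θ s b / Real.pi⌋) ?_ ?_ (Set.finite_Icc _ _)
    · intro x hx
      exact ⟨Int.floor_nonneg.2 (div_nonneg (hpos x hx).le Real.pi_pos.le),
        Int.floor_le_floor (div_le_div_of_nonneg_right (hmono hx.1.2).le Real.pi_pos.le)⟩
    · intro x hx y hy hxy
      obtain ⟨m, hm⟩ := hint x hx
      obtain ⟨n, hn⟩ := hint y hy
      refine hmono.injective ?_
      simpa [← hm, ← hn, Real.pi_ne_zero] using hxy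
  · have hκ : ∀ x ∈ Z, ∃ k ∈ Ioo 0 s, θ k b = θ s x := by
      intro x hx
      -- Intermediate values in the parameter: θ_k(b) is below π at k = 0 and exceeds θ_s(x) ≥ π at
      -- k = s, so it equals this multiple of π for some k in between.
      have := intermediate_value_Ioo hs.le
        (continuous_prufer ha hc F.theta_zero F.hasDerivAt_theta hb.le).continuousOn
        (show θ s x ∈ Ioo (θ 0 b) (θ s b) from
          ⟨(F.theta_parameter_zero_lt_pi ha0 hb).trans_le (hpi x hx), hmono hx.1.2⟩)
      obtain ⟨k, hk, hkθ⟩ := this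
      exact ⟨k, hk, hkθ⟩
    choose! κ hκ1 hκ2 using hκ
    refine ⟨κ, fun x hx y hy hxy => hmono.injective ?_, fun x hx => ⟨hκ1 x hx, ?_⟩⟩
    · rw [← hκ2 x hx, ← hκ2 y hy, hxy]
    · rw [F.eq_zero_iff, hκ2 x hx, ← F.eq_zero_iff]
      exact hx.2

/-- The bound does not depend on k in (0, s), hence is uniform over the eigenvalues of all the
intervals [0, b]. -/
lemma abs_integral_mul_le (F : SolFamily a c θ U V) (ha : Continuous a) (hc : Continuous c)
    {s z k : ℝ} (hz : 0 ≤ z) (hk : k ∈ Ioo 0 s) {g : ℝ → ℝ} (hg : Continuous g) :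
    |∫ x in (0 : ℝ)..z, g x * U k x| ≤
      (∫ x in (0 : ℝ)..z, |g x|) * Real.exp (∫ t in (0 : ℝ)..z, |a t| + s * |c t|) := by
  have hU := (F.isSol k).continuous_fst
  refine (intervalIntegral.abs_integral_le_integral_abs hz).trans ?_
  rw [← intervalIntegral.integral_mul_const]
  refine intervalIntegral.integral_mono_on hz (Continuous.intervalIntegrable (by fun_prop) _ _)
    (Continuous.intervalIntegrable (by fun_prop) _ _) fun x hx => ?_
  rw [abs_mul]
  refine mul_le_mul_of_nonneg_left ((F.abs_le k x hx.1).trans (Real.exp_le_exp.2 ?_)) (abs_nonneg _)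
  have hcont : Continuous fun t => |a t| + s * |c t| := by fun_prop
  refine (intervalIntegral.integral_mono_on hx.1 (Continuous.intervalIntegrable (by fun_prop) _ _)
    (hcont.intervalIntegrable _ _) fun t _ => ?_).trans
    (intervalIntegral.integral_mono_interval le_rfl hx.1 hx.2 (Eventually.of_forall fun t => ?_)
      (hcont.intervalIntegrable _ _))
  · rw [abs_of_pos hk.1]
    have := abs_nonneg (c t)
    nlinarith [hk.2]
  · have := hk.1.trans hk.2
    simp only [Pi.zero_apply]
    positivity

/-- If the solution with parameter `l < s` has a zero, the spectral functions of the problems on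
`[0, b]` are bounded below at `s`, uniformly in `b`. -/
theorem exists_spectral_lower_bound (F : SolFamily a c θ U V) (ha : Continuous a)
    (hc : Continuous c) (ha0 : ∀ x, 0 < a x) (hc0 : ∀ x, 0 < c x) {l s z : ℝ} (hs : 0 < s)
    (hls : l < s) (hz : 0 < z) (hlz : U l z = 0) :
    ∃ ε > 0, ∀ b > z, ∃ K : Finset ℝ, (∀ k ∈ K, U k b = 0 ∧ k < s) ∧
      ε ≤ ∑ k ∈ K, (∫ x in (0 : ℝ)..b, c x * U k x ^ 2)⁻¹ := by
  set D := (s - l) * ∫ x in (0 : ℝ)..z, c x * U l x ^ 2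
  have hD : 0 < D := mul_pos (sub_pos.2 hls) ((F.isSol l).norm_pos hc hc0 ha0 hz)
  set R := (∫ x in (0 : ℝ)..z, |c x * U l x|) * Real.exp (∫ t in (0 : ℝ)..z, |a t| + s * |c t|)
  -- Neither D nor R involves b; the 1 only keeps the denominator positive without proving R ≠ 0.
  refine ⟨D / (s * (R ^ 2 + 1)), by positivity, fun b hb => ?_⟩
  have hb0 : 0 < b := hz.trans hb
  obtain ⟨hfin, κ, hinj, hκ⟩ := F.exists_eigenvalues ha hc ha0 hc0 hs hb0
  set Z := {x | x ∈ Ioo 0 b ∧ U s x = 0} with hZ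
  have : Fintype Z := hfin.fintype
  set N : Z → ℝ := fun y => ∫ x in (0 : ℝ)..b, c x * U (κ y) x ^ 2 with hN
  have hNpos : ∀ y, 0 < N y := fun y => (F.isSol _).norm_pos hc hc0 ha0 hb0
  have hT : ∀ w : Z → ℝ, TestPair a (fun x => ∑ y : Z, U (κ y) x * w y)
      (fun x => ∑ y : Z, V (κ y) x * w y) := fun w =>
    TestPair.sum (fun y : Z => (F.isSol (κ y)).testPair) w
  have hzero : ∀ w : Z → ℝ, ∑ y : Z, U (κ y) 0 * w y = 0 := fun w =>
    Finset.sum_eq_zero fun y _ => by rw [(F.isSol _).fst_zero, zero_mul]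
  have hbzero : ∀ w : Z → ℝ, ∑ y : Z, U (κ y) b * w y = 0 := fun w =>
    Finset.sum_eq_zero fun y _ => by rw [(hκ y y.2).2, zero_mul]
  have hcU : ∀ k, Continuous (U k) := fun k => (F.isSol k).continuous_fst
  have hcV : ∀ k, Continuous (V k) := fun k => (F.isSol k).continuous_snd
  -- Orthogonality diagonalizes the energy; all its coefficients are negative since κ_y < s.
  have hE : ∀ w : Z → ℝ, ∫ x in (0 : ℝ)..b, (a x * (∑ y : Z, V (κ y) x * w y) ^ 2 -
      s * c x * (∑ y : Z, U (κ y) x * w y) ^ 2) = ∑ y : Z, (κ y - s) * N y * w y ^ 2 := by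
    intro w
    have h1 := integral_form_sum ha hc (fun y : Z => F.isSol (κ y)) w s (hT w) (hzero w) (hbzero w)
    simp only [sq, ← mul_assoc] at h1 ⊢
    rw [h1]
    refine Finset.sum_congr rfl fun y _ => ?_
    have h2 : ∫ x in (0 : ℝ)..b, c x * (∑ y' : Z, U (κ y') x * w y') * U (κ y) x =
        ∑ y' : Z, w y' * ∫ x in (0 : ℝ)..b, c x * U (κ y') x * U (κ y) x := by
      simp_rw [← intervalIntegral.integral_const_mul]
      rw [← intervalIntegral.integral_finsetSum
        (fun i _ => Continuous.intervalIntegrable (by fun_prop) _ _)]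
      congr 1 with x
      rw [Finset.mul_sum, Finset.sum_mul]
      exact Finset.sum_congr rfl fun i _ => by ring
    rw [h2, Finset.sum_eq_single y]
    · simp only [hN, sq, ← mul_assoc]; ring
    · intro y' _ hy'
      rw [(F.isSol _).orthogonal ha hc (F.isSol _) (fun h => hy' (Subtype.ext
        (hinj y'.2 y.2 h))) (hκ y' y'.2).2 (hκ y y.2).2, mul_zero]
    · simp
  have hκs : ∀ y : Z, κ y - s < 0 := fun y => sub_neg.2 (hκ y y.2).1.2
  let M : Matrix Z Z ℝ := fun x y => U (κ y) x
  have hM : ∀ w x, M.mulVecLin w x = ∑ y : Z, U (κ y) x * w y := fun w x => rfl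
  -- If a combination vanishes at every zero of `U s`, Jacobi's inequality makes its energy
  -- nonnegative, and negative definiteness forces it to be trivial. There are as many
  -- eigenfunctions as zeros, so evaluation is also surjective.
  have hker : Function.Injective M.mulVecLin := by
    rw [← LinearMap.ker_eq_bot, LinearMap.ker_eq_bot']
    intro w hw
    have hj := (F.isSol s).jacobi ha hc ha0 (F.snd_ne_zero s) (hT w) hb0.le (fun x hx hx0 => by
      rcases hx.1.eq_or_lt with h | h
      · rw [← h]; exact hzero w
      rcases hx.2.eq_or_lt with h' | h'
      · rw [h']; exact hbzero w
      · have := congrFun hw ⟨x, ⟨h, h'⟩, hx0⟩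
        rwa [hM] at this)
    rw [hE, hzero, hbzero] at hj
    have hle : ∀ y ∈ (Finset.univ : Finset Z), (κ y - s) * N y * w y ^ 2 ≤ 0 := fun y _ =>
      mul_nonpos_of_nonpos_of_nonneg (mul_neg_of_neg_of_pos (hκs y) (hNpos y)).le (sq_nonneg _)
    have h0 := (Finset.sum_eq_zero_iff_of_nonpos hle).1
      (le_antisymm (Finset.sum_nonpos hle) (by simpa using hj))
    ext y
    have := h0 y (Finset.mem_univ _)
    simpa [(hκs y).ne, (hNpos y).ne'] using this
  have hsurj : Function.Surjective M.mulVecLin := LinearMap.injective_iff_surjective.1 hker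
  -- Interpolate `U l` cut off at z. Jacobi's inequality is then applied to `U l` - ψ on [0, z] and
  -- to -ψ, equivalently ψ, on [z, b]; since `U l` vanishes at z, the two boundary terms there
  -- cancel.
  obtain ⟨w, hw⟩ := hsurj fun x => if (x : ℝ) ≤ z then U l x else 0
  have hw' : ∀ x, x ∈ Ioo 0 b → U s x = 0 →
      ∑ y : Z, U (κ y) x * w y = if x ≤ z then U l x else 0 := fun x hx hx0 => by
    have := congrFun hw ⟨x, hx, hx0⟩
    rwa [hM] at this
  have j1 := (F.isSol s).jacobi ha hc ha0 (F.snd_ne_zero s) ((F.isSol l).testPair.sub (hT w)) hz.le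
    (fun x hx hx0 => by
      rcases hx.1.eq_or_lt with h | h
      · rw [← h, hzero, (F.isSol l).fst_zero, sub_zero]
      · rw [hw' x ⟨h, hx.2.trans_lt hb⟩ hx0, if_pos hx.2, sub_self])
  have j2 := (F.isSol s).jacobi ha hc ha0 (F.snd_ne_zero s) (hT w) hb.le
    (fun x hx hx0 => by
      rcases hx.2.eq_or_lt with h' | h'
      · rw [h']; exact hbzero w
      rw [hw' x ⟨hz.trans_le hx.1, h'⟩ hx0]
      split_ifs with h
      · rw [le_antisymm h hx.1, hlz]
      · rfl)
  have hexp : ∫ x in (0 : ℝ)..z, (a x * (V l x - ∑ y : Z, V (κ y) x * w y) ^ 2 -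
      s * c x * (U l x - ∑ y : Z, U (κ y) x * w y) ^ 2) =
      (∫ x in (0 : ℝ)..z, (a x * V l x ^ 2 - s * c x * U l x ^ 2)) -
      2 * (∫ x in (0 : ℝ)..z, (a x * V l x * (∑ y : Z, V (κ y) x * w y) -
        s * c x * U l x * (∑ y : Z, U (κ y) x * w y))) +
      ∫ x in (0 : ℝ)..z, (a x * (∑ y : Z, V (κ y) x * w y) ^ 2 -
        s * c x * (∑ y : Z, U (κ y) x * w y) ^ 2) := by
    rw [← intervalIntegral.integral_const_mul, ← intervalIntegral.integral_sub
      (Continuous.intervalIntegrable (by fun_prop) _ _)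
      (Continuous.intervalIntegrable (by fun_prop) _ _), ← intervalIntegral.integral_add
      (Continuous.intervalIntegrable (by fun_prop) _ _)
      (Continuous.intervalIntegrable (by fun_prop) _ _)]
    congr 1 with x
    ring
  have hadd := intervalIntegral.integral_add_adjacent_intervals (a := 0) (b := z) (c := b)
    (μ := volume) (f := fun x => a x * (∑ y : Z, V (κ y) x * w y) ^ 2 -
        s * c x * (∑ y : Z, U (κ y) x * w y) ^ 2)
    (Continuous.intervalIntegrable (by fun_prop) _ _)
    (Continuous.intervalIntegrable (by fun_prop) _ _)
  rw [hE] at hadd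
  rw [hexp, (F.isSol l).energy_eq ha hc s hlz, integral_form_sum ha hc
    (fun y : Z => F.isSol (κ y)) w s (F.isSol l).testPair (F.isSol l).fst_zero hlz, hlz, hzero,
    (F.isSol l).fst_zero] at j1
  rw [hbzero] at j2
  set A : Z → ℝ := fun y => ∫ x in (0 : ℝ)..z, c x * U l x * U (κ y) x with hA
  have hAle : ∀ y, A y ^ 2 ≤ R ^ 2 := fun y => by
    rw [← sq_abs]
    exact pow_le_pow_left₀ (abs_nonneg _)
      (F.abs_integral_mul_le ha hc hz.le (hκ y y.2).1 (by fun_prop)) 2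
  have hsum : D ≤ ∑ y : Z, s * (R ^ 2 + 1) * (N y)⁻¹ := by
    -- The sum of `j1` and `j2`, with the square expanded: the energy of `U l` on [0, z] is -D, and
    -- the energies of ψ on the two pieces add up to the diagonal form.
    have h1 : D ≤ ∑ y : Z, (s - κ y) * (2 * w y * A y - N y * w y ^ 2) := by
      have e : ∑ y : Z, (s - κ y) * (2 * w y * A y - N y * w y ^ 2) =
          (-2) * (∑ y : Z, w y * (κ y - s) * A y) + ∑ y : Z, (κ y - s) * N y * w y ^ 2 := by
        rw [Finset.mul_sum, ← Finset.sum_add_distrib]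
        exact Finset.sum_congr rfl fun y _ => by ring
      rw [e]
      simp only [D]
      simp only [zero_sub, neg_sq, sub_self, ne_eq, OfNat.ofNat_ne_zero, not_false_eq_true,
        zero_pow, zero_mul, zero_div, sub_zero] at j1 j2
      linarith
    refine h1.trans (Finset.sum_le_sum fun y _ => ?_)
    have hp := hNpos y
    have hk := hκ y y.2
    -- Completing the square eliminates the unknown coefficients w.
    have h2 : 2 * w y * A y - N y * w y ^ 2 ≤ A y ^ 2 * (N y)⁻¹ := by
      have : A y ^ 2 * (N y)⁻¹ - (2 * w y * A y - N y * w y ^ 2) =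
        N y * (w y - A y * (N y)⁻¹) ^ 2 := by field_simp; ring
      have := mul_nonneg hp.le (sq_nonneg (w y - A y * (N y)⁻¹))
      linarith
    have h3 : A y ^ 2 * (N y)⁻¹ ≤ (R ^ 2 + 1) * (N y)⁻¹ :=
      mul_le_mul_of_nonneg_right ((hAle y).trans (by linarith)) (inv_nonneg.2 hp.le)
    have h4 : 0 ≤ (R ^ 2 + 1) * (N y)⁻¹ := by positivity
    have h5 := hk.1.1
    have h6 := hk.1.2
    nlinarith
  refine ⟨Finset.univ.image fun y : Z => κ y, fun k hk => ?_, ?_⟩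
  · obtain ⟨y, -, rfl⟩ := Finset.mem_image.1 hk
    exact ⟨(hκ y y.2).2, (hκ y y.2).1.2⟩
  · rw [Finset.sum_image fun x _ y _ h => Subtype.ext (hinj x.2 y.2 h),
      div_le_iff₀ (by positivity), Finset.sum_mul]
    refine hsum.trans (le_of_eq (Finset.sum_congr rfl fun y _ => ?_))
    rw [hN]; ring

end SolFamily

end

/-! ### Sturm comparison and Muckenhoupt's criterion -/

section

variable {a c : ℝ → ℝ} {θ U V : ℝ → ℝ → ℝ}

lemma hasDerivAt_integral_zero {f : ℝ → ℝ} (hf : Continuous f) (x : ℝ) :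
    HasDerivAt (fun x => ∫ t in (0 : ℝ)..x, f t) (f x) x :=
  intervalIntegral.integral_hasDerivAt_right (hf.intervalIntegrable _ _)
    hf.aestronglyMeasurable.stronglyMeasurableAtFilter hf.continuousAt

lemma integral_zero_pos {f : ℝ → ℝ} (hf : Continuous f) (hf0 : ∀ x, 0 < f x) {x : ℝ}
    (hx : 0 < x) : 0 < ∫ t in (0 : ℝ)..x, f t :=
  intervalIntegral.intervalIntegral_pos_of_pos (hf.intervalIntegrable _ _) hf0 hx

/-- A solution without zeros on `(0, ∞)` is positive there. -/
lemma IsSol.pos_of_ne_zero (ha0 : ∀ x, 0 < a x) {l : ℝ} {u v : ℝ → ℝ} (H : IsSol a c l u v)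
    (hne : ∀ x > 0, u x ≠ 0) {x : ℝ} (hx : 0 < x) : 0 < u x := by
  have hd := H.hasDerivAt_fst 0
  rw [H.snd_zero, mul_one, hasDerivAt_iff_tendsto_slope] at hd
  have hev : ∀ᶠ y in 𝓝[>] (0 : ℝ), 0 < slope u 0 y :=
    (hd.mono_left (nhdsWithin_mono _ fun y hy => ne_of_gt hy)).eventually_const_lt (ha0 0)
  obtain ⟨y, hy, hy0⟩ := (hev.and self_mem_nhdsWithin).exists
  have hy0' : (0 : ℝ) < y := hy0
  have huy : 0 < u y := by
    rw [slope_def_field, H.fst_zero, sub_zero, sub_zero] at hy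
    exact (div_pos_iff_of_pos_right hy0').1 hy
  by_contra! h
  obtain ⟨w, hw, hw0⟩ := isPreconnected_Ioi.intermediate_value (s := Ioi (0 : ℝ)) (a := x) (b := y)
    hx hy0 H.continuous_fst.continuousOn ⟨h, huy.le⟩
  exact hne w hw hw0

namespace SolFamily

/-- Sturm comparison: if the solution with parameter `m` has no zeros on `(0, ∞)`, then neither
have those with smaller parameters. -/
lemma ne_zero_of_lt (F : SolFamily a c θ U V) (ha : Continuous a) (hc : Continuous c)
    (ha0 : ∀ x, 0 < a x) (hc0 : ∀ x, 0 < c x) {l m : ℝ} (hlm : l < m)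
    (hm : ∀ x > 0, U m x ≠ 0) : ∀ x > 0, U l x ≠ 0 := by
  intro b hb hU
  have hj := (F.isSol m).jacobi ha hc ha0 (F.snd_ne_zero m) (F.isSol l).testPair hb.le
    (fun x hx hx0 => by
      rcases hx.1.eq_or_lt with h | h
      · rw [← h, (F.isSol l).fst_zero]
      · exact absurd hx0 (hm x h))
  rw [(F.isSol l).energy_eq ha hc m hU, hU, (F.isSol l).fst_zero] at hj
  have := (F.isSol l).norm_pos hc hc0 ha0 hb
  have := mul_pos (sub_pos.2 hlm) this
  norm_num at hj
  linarith

/-- Jacobi's inequality on [0, 1] with the test function Λ (Λ(1) - Λ), which vanishes at both ends,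
bounds l by a Rayleigh quotient. -/
lemma bddAbove_parameters (F : SolFamily a c θ U V) (ha : Continuous a) (hc : Continuous c)
    (ha0 : ∀ x, 0 < a x) (hc0 : ∀ x, 0 < c x) : BddAbove {l | ∀ x > 0, U l x ≠ 0} := by
  set Λ : ℝ → ℝ := fun x => ∫ t in (0 : ℝ)..x, a t with hΛ
  have hd : ∀ x, HasDerivAt Λ (a x) x := hasDerivAt_integral_zero ha
  have hΛc : Continuous Λ := continuous_iff_continuousAt.2 fun x => (hd x).continuousAt
  have hΛ0 : Λ 0 = 0 := by simp [hΛ]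
  have hT : TestPair a (fun x => Λ x * (Λ 1 - Λ x)) (fun x => Λ 1 - 2 * Λ x) := by
    refine ⟨fun x => ?_, by fun_prop⟩
    convert! (hd x).mul ((hd x).const_sub (Λ 1)) using 1
    ring
  have hI : 0 < ∫ x in (0 : ℝ)..1, c x * (Λ x * (Λ 1 - Λ x)) ^ 2 := by
    refine intervalIntegral.integral_pos one_pos (Continuous.continuousOn (by fun_prop))
      (fun y _ => mul_nonneg (hc0 y).le (sq_nonneg _)) ⟨1 / 2, ⟨by norm_num, by norm_num⟩, ?_⟩
    have hm : StrictMono Λ := strictMono_of_hasDerivAt_pos hd ha0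
    have h1 : 0 < Λ (1 / 2) := by rw [← hΛ0]; exact hm (by norm_num)
    have h2 : 0 < Λ 1 - Λ (1 / 2) := sub_pos.2 (hm (by norm_num))
    have := hc0 (1 / 2)
    positivity
  refine ⟨(∫ x in (0 : ℝ)..1, a x * (Λ 1 - 2 * Λ x) ^ 2) /
    ∫ x in (0 : ℝ)..1, c x * (Λ x * (Λ 1 - Λ x)) ^ 2, fun l hl => ?_⟩
  have hj := (F.isSol l).jacobi ha hc ha0 (F.snd_ne_zero l) hT zero_le_one (fun x hx hx0 => by
    rcases hx.1.eq_or_lt with h | h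
    · rw [← h, hΛ0, zero_mul]
    · exact absurd hx0 (hl x h))
  have e : ∀ x, a x * (Λ 1 - 2 * Λ x) ^ 2 - l * c x * (Λ x * (Λ 1 - Λ x)) ^ 2 =
    a x * (Λ 1 - 2 * Λ x) ^ 2 - l * (c x * (Λ x * (Λ 1 - Λ x)) ^ 2) := fun x => by ring
  simp_rw [e] at hj
  rw [intervalIntegral.integral_sub (Continuous.intervalIntegrable (by fun_prop) _ _)
    (Continuous.intervalIntegrable (by fun_prop) _ _), intervalIntegral.integral_const_mul,
    hΛ0] at hj
  norm_num at hj
  rw [le_div_iff₀ hI]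
  exact hj

/-- Muckenhoupt's criterion, sufficiency: if `Λ M ≤ D` then the solutions with parameter below
`1 / (4 D)` have no zeros on `(0, ∞)`. -/
lemma ne_zero_of_mul_le (F : SolFamily a c θ U V) (ha : Continuous a) (hc : Continuous c)
    (ha0 : ∀ x, 0 < a x) (hc0 : ∀ x, 0 < c x) {Λ M : ℝ → ℝ} {D : ℝ}
    (hΛ : ∀ x, HasDerivAt Λ (a x) x) (hΛ0 : Λ 0 = 0) (hΛpos : ∀ x > 0, 0 < Λ x)
    (hM : ∀ x, HasDerivAt M (-c x) x) (hMpos : ∀ x > 0, 0 ≤ M x) (hD : 0 < D)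
    (hΛM : ∀ x > 0, Λ x * M x ≤ D) {l : ℝ} (hl : l < 1 / (4 * D)) : ∀ x > 0, U l x ≠ 0 := by
  intro z hz hU
  set m := 1 / (4 * D)
  have hUd := (F.isSol l).hasDerivAt_fst
  have hUc := (F.isSol l).continuous_fst
  have hVc := (F.isSol l).continuous_snd
  -- The function G = m M u² + u² / (4Λ) vanishes at 0 and at the supposed zero z, and G' is at most
  -- the energy density with parameter m. So that energy is nonnegative, whereas it equals (l - m)∫
  -- c u² < 0.
  have hd : ∀ x ∈ Icc 0 z, HasDerivAt
      (fun y => m * (M y * U l y ^ 2) + U l y ^ 2 * 1 / (4 * Λ y))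
      (m * (-c x * U l x ^ 2 + M x * (2 * U l x * (a x * V l x))) +
        if x = 0 then (a x * V l x) ^ 2 * 1 / (4 * a x) else
          (2 * U l x * (a x * V l x) * (4 * Λ x) - U l x ^ 2 * (4 * a x)) / (4 * Λ x) ^ 2) x := by
    intro x hx
    have h1 := (hUd x).pow 2
    simp only [Nat.add_one_sub_one, pow_one, Nat.cast_ofNat] at h1
    refine (((hM x).mul h1).const_mul m).add ?_
    split_ifs with h
    · subst h
      exact hasDerivAt_sq_div (hUd 0) ((hΛ 0).const_mul 4) (w := fun _ => 1) continuousAt_const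
        (F.isSol l).fst_zero (by rw [hΛ0, mul_zero]) (mul_ne_zero four_ne_zero (ha0 0).ne')
    · have hx0 := hΛpos x (lt_of_le_of_ne hx.1 (Ne.symm h))
      simp only [mul_one]
      exact h1.div ((hΛ x).const_mul 4) (by positivity)
  have key := intervalIntegral.sub_le_integral_of_hasDeriv_right_of_le hz.le
    (HasDerivAt.continuousOn hd) (fun x hx => (hd x (Ioo_subset_Icc_self hx)).hasDerivWithinAt)
    (φ := fun x => a x * V l x ^ 2 - m * c x * U l x ^ 2)
    (Continuous.integrableOn_Icc (by fun_prop)) fun x hx => by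
      rw [if_neg hx.1.ne']
      have h0 := hΛpos x hx.1
      have h1 := hMpos x hx.1
      -- The choice m = 1 / (4D) makes the two terms of w at most 1 / (4Λ) each, so the term u² w²
      -- from 2 u v w ≤ v² + u² w² is absorbed by u² / (4Λ²).
      have h2 : m * M x ≤ 1 / (4 * Λ x) := by
        rw [le_div_iff₀ (by positivity)]
        have := hΛM x hx.1
        have hm : m * D = 1 / 4 := by simp only [m]; field_simp
        have hm0 : 0 < m := by positivity
        nlinarith
      set w := m * M x + 1 / (4 * Λ x)
      have hw0 : 0 ≤ w := by positivity
      have hw : w ^ 2 ≤ 1 / (4 * Λ x ^ 2) := by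
        have h3 : w ≤ 1 / (2 * Λ x) := by
          have : 1 / (4 * Λ x) + 1 / (4 * Λ x) = 1 / (2 * Λ x) := by field_simp; norm_num
          simp only [w]; linarith
        calc w ^ 2 ≤ (1 / (2 * Λ x)) ^ 2 := pow_le_pow_left₀ hw0 h3 2
          _ = 1 / (4 * Λ x ^ 2) := by field_simp; norm_num
      have e : m * (-c x * U l x ^ 2 + M x * (2 * U l x * (a x * V l x))) +
          (2 * U l x * (a x * V l x) * (4 * Λ x) - U l x ^ 2 * (4 * a x)) / (4 * Λ x) ^ 2 =
          -m * c x * U l x ^ 2 +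
            a x * (2 * U l x * V l x * w - U l x ^ 2 * (1 / (4 * Λ x ^ 2))) := by
        simp only [w]; field_simp; ring
      rw [e]
      have h4 : 2 * U l x * V l x * w - U l x ^ 2 * (1 / (4 * Λ x ^ 2)) ≤ V l x ^ 2 := by
        nlinarith [sq_nonneg (V l x - U l x * w), mul_le_mul_of_nonneg_left hw (sq_nonneg (U l x))]
      nlinarith [mul_le_mul_of_nonneg_left h4 (ha0 x).le]
  rw [(F.isSol l).energy_eq ha hc m hU, hU, (F.isSol l).fst_zero] at key
  have := mul_pos (sub_pos.2 hl) ((F.isSol l).norm_pos hc hc0 ha0 hz)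
  norm_num at key
  linarith

/-- Muckenhoupt's criterion, necessity. -/
lemma mul_integral_le (F : SolFamily a c θ U V) (ha0 : ∀ x, 0 < a x) (hc0 : ∀ x, 0 < c x)
    {Λ C : ℝ → ℝ} (hΛ : ∀ x, HasDerivAt Λ (a x) x) (hΛ0 : Λ 0 = 0)
    (hΛpos : ∀ x > 0, 0 < Λ x) (hΛtop : Tendsto Λ atTop atTop)
    (hC : ∀ x, HasDerivAt C (c x) x) {l : ℝ} (hl : 0 < l) (hne : ∀ x > 0, U l x ≠ 0) {x y : ℝ}
    (hx : 0 < x) (hxy : x < y) : l * (Λ x * (C y - C x)) ≤ 1 := by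
  have hU : ∀ x > 0, 0 < U l x := fun x hx => (F.isSol l).pos_of_ne_zero ha0 hne hx
  have hUd := (F.isSol l).hasDerivAt_fst
  have hVd := (F.isSol l).hasDerivAt_snd
  have hVanti : AntitoneOn (V l) (Ici 0) := by
    refine antitoneOn_of_hasDerivWithinAt_nonpos (convex_Ici 0)
      (HasDerivAt.continuousOn fun x _ => hVd x) (fun x _ => (hVd x).hasDerivWithinAt) fun x hx => ?_
    rw [interior_Ici] at hx
    have := mul_pos (mul_pos hl (hc0 x)) (hU x hx)
    linarith
  -- Once v is negative it stays below a negative constant, so u is dominated by a negative multiple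
  -- of Λ plus a constant and would become negative as Λ → ∞.
  have hV : ∀ x > 0, 0 ≤ V l x := by
    intro x hx
    by_contra! hneg
    have hmono : AntitoneOn (fun y => U l y - V l x * Λ y) (Ici x) := by
      have hd : ∀ y, HasDerivAt (fun y => U l y - V l x * Λ y) (a y * V l y - V l x * a y) y :=
        fun y => (hUd y).sub ((hΛ y).const_mul _)
      refine antitoneOn_of_hasDerivWithinAt_nonpos (convex_Ici x)
        (HasDerivAt.continuousOn fun y _ => hd y) (fun y _ => (hd y).hasDerivWithinAt)
        fun y hy => ?_
      rw [interior_Ici] at hy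
      have := hVanti hx.le (hx.trans hy).le (le_of_lt hy)
      nlinarith [ha0 y]
    have ht : Tendsto (fun y => U l x - V l x * Λ x + V l x * Λ y) atTop atBot :=
      tendsto_atBot_add_const_left _ _ (hΛtop.const_mul_atTop_of_neg hneg)
    obtain ⟨y, hy, hy'⟩ := ((ht.eventually_lt_atBot 0).and (eventually_ge_atTop x)).exists
    have h1 := hmono self_mem_Ici hy' hy'
    have h2 := hU y (hx.trans_le hy')
    simp only at h1
    linarith
  have hUmono : MonotoneOn (U l) (Ici 0) := by
    refine monotoneOn_of_hasDerivWithinAt_nonneg (convex_Ici 0)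
      (HasDerivAt.continuousOn fun x _ => hUd x) (fun x _ => (hUd x).hasDerivWithinAt) fun x hx => ?_
    rw [interior_Ici] at hx
    exact mul_nonneg (ha0 x).le (hV x hx)
  -- The derivative of u - Λ v is l Λ c u ≥ 0.
  have h1 : Λ x * V l x ≤ U l x := by
    have hd : ∀ y, HasDerivAt (fun y => U l y - Λ y * V l y)
        (a y * V l y - (a y * V l y + Λ y * (-l * c y * U l y))) y :=
      fun y => (hUd y).sub ((hΛ y).mul (hVd y))
    have hm : MonotoneOn (fun y => U l y - Λ y * V l y) (Ici 0) := by
      refine monotoneOn_of_hasDerivWithinAt_nonneg (convex_Ici 0)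
        (HasDerivAt.continuousOn fun y _ => hd y) (fun y _ => (hd y).hasDerivWithinAt)
        fun y hy => ?_
      rw [interior_Ici] at hy
      have := mul_pos (hΛpos y hy) (mul_pos (mul_pos hl (hc0 y)) (hU y hy))
      linarith
    have := hm self_mem_Ici hx.le hx.le
    simp only [(F.isSol l).fst_zero, hΛ0] at this
    linarith
  -- The drop of v is the integral of l c u, and u is increasing.
  have h2 : l * U l x * (C y - C x) ≤ V l x - V l y := by
    have hd : ∀ y, HasDerivAt (fun y => V l y + l * U l x * C y)
        (-l * c y * U l y + l * U l x * c y) y := fun y => (hVd y).add ((hC y).const_mul _)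
    have hm : AntitoneOn (fun y => V l y + l * U l x * C y) (Ici x) := by
      refine antitoneOn_of_hasDerivWithinAt_nonpos (convex_Ici x)
        (HasDerivAt.continuousOn fun y _ => hd y) (fun y _ => (hd y).hasDerivWithinAt)
        fun y hy => ?_
      rw [interior_Ici] at hy
      have := hUmono hx.le (hx.trans hy).le (le_of_lt hy)
      nlinarith [mul_pos hl (hc0 y)]
    have := hm self_mem_Ici hxy.le hxy.le
    simp only at this
    linarith
  have h3 : 0 < C y - C x := sub_pos.2 (strictMono_of_hasDerivAt_pos hC hc0 hxy)
  have h4 := hV y (hx.trans hxy)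
  have h5 : 0 < V l x := by
    have := mul_pos (mul_pos hl (hU x hx)) h3
    linarith
  have h6 : V l x * (l * (Λ x * (C y - C x))) ≤ V l x * 1 := by
    have := mul_le_mul_of_nonneg_left h1 (mul_pos hl h3).le
    linarith
  exact le_of_mul_le_mul_left h6 h5

end SolFamily

end

/-! ### Identification of φ_l with the first order system -/

/-- The continuous extension of `q` from `[0, ∞)` to `ℝ` by a constant. -/
def extend (q : ℝ → ℝ) (x : ℝ) : ℝ := q (max x 0)

lemma continuous_extend {q : ℝ → ℝ} (hq : ContDiffOn ℝ 1 q (Ici 0)) : Continuous (extend q) :=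
  hq.continuousOn.comp_continuous (by fun_prop) fun x => le_max_right x 0

lemma extend_of_nonneg (q : ℝ → ℝ) {x : ℝ} (hx : 0 ≤ x) : extend q x = q x := by
  rw [extend, max_eq_left hx]

lemma Q_extend (q : ℝ → ℝ) {x : ℝ} (hx : 0 ≤ x) : Q (extend q) x = Q q x := by
  refine intervalIntegral.integral_congr fun t ht => ?_
  rw [uIcc_of_le hx] at ht
  simp only [extend_of_nonneg q ht.1]

/-- The scale density `e^Q`. -/
def scaleDensity (q : ℝ → ℝ) (x : ℝ) : ℝ := Real.exp (Q (extend q) x)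

/-- The speed density `2 e^{-Q}`. -/
def speedDensity (q : ℝ → ℝ) (x : ℝ) : ℝ := 2 * Real.exp (-Q (extend q) x)

lemma scaleDensity_pos (q : ℝ → ℝ) (x : ℝ) : 0 < scaleDensity q x := Real.exp_pos _

lemma speedDensity_pos (q : ℝ → ℝ) (x : ℝ) : 0 < speedDensity q x := by
  unfold speedDensity; positivity

lemma speedDensity_mul_scaleDensity (q : ℝ → ℝ) (x : ℝ) :
    speedDensity q x * scaleDensity q x = 2 := by
  rw [speedDensity, scaleDensity, mul_assoc, ← Real.exp_add]; simp

section

variable {q : ℝ → ℝ}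

lemma hasDerivAt_Q_extend (hq : ContDiffOn ℝ 1 q (Ici 0)) (x : ℝ) :
    HasDerivAt (Q (extend q)) (2 * extend q x) x :=
  hasDerivAt_integral_zero (continuous_const.mul (continuous_extend hq)) x

lemma continuous_Q_extend (hq : ContDiffOn ℝ 1 q (Ici 0)) : Continuous (Q (extend q)) :=
  continuous_iff_continuousAt.2 fun x => (hasDerivAt_Q_extend hq x).continuousAt

lemma continuous_scaleDensity (hq : ContDiffOn ℝ 1 q (Ici 0)) : Continuous (scaleDensity q) :=
  Real.continuous_exp.comp (continuous_Q_extend hq)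

lemma continuous_speedDensity (hq : ContDiffOn ℝ 1 q (Ici 0)) : Continuous (speedDensity q) :=
  continuous_const.mul (Real.continuous_exp.comp (continuous_Q_extend hq).neg)

lemma contDiffOn_one_of_hasDerivWithinAt {f f' : ℝ → ℝ} {s : Set ℝ} (hs : UniqueDiffOn ℝ s)
    (hf : ∀ x ∈ s, HasDerivWithinAt f (f' x) s x) (hf' : ContinuousOn f' s) :
    ContDiffOn ℝ 1 f s := by
  rw [show (1 : WithTop ℕ∞) = 0 + 1 from (zero_add 1).symm, contDiffOn_succ_iff_derivWithin hs]
  refine ⟨fun x hx => (hf x hx).differentiableWithinAt, by simp, contDiffOn_zero.2 ?_⟩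
  exact hf'.congr fun x hx => (hf x hx).derivWithin (hs x hx)

/-- With φ = e^{-Q} u one has φ' + 2qφ = v, so L*φ = v' / 2 = -l e^{-Q} u. -/
lemma IsSol.isPhi (hq : ContDiffOn ℝ 1 q (Ici 0)) {l : ℝ} {u v : ℝ → ℝ}
    (H : IsSol (scaleDensity q) (speedDensity q) l u v) :
    IsPhi q l fun x => Real.exp (-Q (extend q) x) * u x := by
  have hs := uniqueDiffOn_Ici (0 : ℝ)
  have hu := H.continuous_fst
  have hv := H.continuous_snd
  have hQ := continuous_Q_extend hq
  set φ : ℝ → ℝ := fun x => Real.exp (-Q (extend q) x) * u x with hφ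
  have hd : ∀ x ∈ Ici (0 : ℝ), HasDerivWithinAt φ (-2 * (q x * φ x) + v x) (Ici 0) x := by
    intro x hx
    refine HasDerivAt.hasDerivWithinAt ?_
    convert! (hasDerivAt_Q_extend hq x).neg.exp.mul (H.hasDerivAt_fst x) using 1
    rw [extend_of_nonneg q hx, scaleDensity, ← mul_assoc (Real.exp _), ← Real.exp_add, hφ]
    simp only [Pi.neg_apply, neg_add_cancel, Real.exp_zero]
    ring
  have hφ1 : ContDiffOn ℝ 1 φ (Ici 0) := contDiffOn_one_of_hasDerivWithinAt hs hd
    (by have := hq.continuousOn; fun_prop)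
  have hqφ : ContDiffOn ℝ 1 (fun y => q y * φ y) (Ici 0) := hq.mul hφ1
  have hv1 : ContDiffOn ℝ 1 v (Ici 0) := contDiffOn_one_of_hasDerivWithinAt hs
    (fun x _ => (H.hasDerivAt_snd x).hasDerivWithinAt)
    (by have := continuous_speedDensity hq; fun_prop)
  have hder : EqOn (derivWithin φ (Ici 0)) (fun x => -2 * (q x * φ x) + v x) (Ici 0) :=
    fun x hx => (hd x hx).derivWithin (hs x hx)
  refine ⟨?_, fun x hx => ?_, by simp [hφ, H.fst_zero], ?_⟩
  · rw [show (2 : WithTop ℕ∞) = 1 + 1 from one_add_one_eq_two.symm,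
      contDiffOn_succ_iff_derivWithin hs]
    exact ⟨fun x hx => (hd x hx).differentiableWithinAt, by simp,
      ((contDiffOn_const.mul hqφ).add hv1).congr hder⟩
  · have h1 := ((hqφ.differentiableOn one_ne_zero) x hx).hasDerivWithinAt
    have h2 := (h1.const_mul (-2)).add (H.hasDerivAt_snd x).hasDerivWithinAt
    have h3 := h2.congr_of_mem hder hx
    rw [LStar, h3.derivWithin (hs x hx), speedDensity, hφ]
    ring
  · rw [hder self_mem_Ici, hφ]
    simp [H.fst_zero, H.snd_zero]

/-- The initial value problem for `φ_l` has at most one solution on `[0, ∞)`. -/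
lemma IsPhi.eq_of_isSol (hq : ContDiffOn ℝ 1 q (Ici 0)) {l : ℝ} {u v φ : ℝ → ℝ}
    (H : IsSol (scaleDensity q) (speedDensity q) l u v) (hφ : IsPhi q l φ) {x : ℝ} (hx : 0 ≤ x) :
    φ x = Real.exp (-Q (extend q) x) * u x := by
  obtain ⟨hφ2, hL, hφ0, hφ1⟩ := hφ
  have hs := uniqueDiffOn_Ici (0 : ℝ)
  rw [show (2 : WithTop ℕ∞) = 1 + 1 from one_add_one_eq_two.symm,
    contDiffOn_succ_iff_derivWithin hs] at hφ2
  obtain ⟨hφd, -, hφd2⟩ := hφ2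
  have hu' : ∀ t ∈ Ici (0 : ℝ), HasDerivWithinAt (fun y => scaleDensity q y * φ y)
      (scaleDensity q t * (derivWithin φ (Ici 0) t + 2 * (q t * φ t))) (Ici 0) t := by
    intro t ht
    convert! (hasDerivAt_Q_extend hq t).exp.hasDerivWithinAt.mul (hφd t ht).hasDerivWithinAt using 1
    rw [extend_of_nonneg q ht, scaleDensity]
    ring
  have hv' : ∀ t ∈ Ici (0 : ℝ), HasDerivWithinAt
      (fun y => derivWithin φ (Ici 0) y + 2 * (q y * φ y))
      (-l * speedDensity q t * (scaleDensity q t * φ t)) (Ici 0) t := by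
    intro t ht
    have h1 : DifferentiableWithinAt ℝ (fun y => q y * φ y) (Ici 0) t :=
      (hq.differentiableOn one_ne_zero t ht).mul (hφd t ht)
    convert! ((hφd2.differentiableOn one_ne_zero) t ht).hasDerivWithinAt.add
      (h1.hasDerivWithinAt.const_mul 2) using 1
    have h2 := hL t ht
    rw [LStar] at h2
    have h3 := speedDensity_mul_scaleDensity q t
    linear_combination (-l * φ t) * h3 - 2 * h2
  obtain ⟨C₁, hC₁, hC₁'⟩ := exists_abs_le_Icc (continuous_scaleDensity hq) 0 x
  obtain ⟨C₂, hC₂, hC₂'⟩ := exists_abs_le_Icc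
    (f := fun t => -l * speedDensity q t) (continuous_const.mul (continuous_speedDensity hq)) 0 x
  have hsub : ∀ t ∈ Ico 0 x, Ici t ⊆ Ici (0 : ℝ) := fun t ht => Ici_subset_Ici.2 ht.1
  have key := ODE_solution_unique_of_mem_Icc_right (a := 0) (b := x)
    (v := fun t (p : ℝ × ℝ) => (scaleDensity q t * p.2, -l * speedDensity q t * p.1))
    (s := fun _ => univ) (K := ⟨C₁ + C₂, by positivity⟩)
    (f := fun y => (scaleDensity q y * φ y, derivWithin φ (Ici 0) y + 2 * (q y * φ y)))
    (g := fun y => (u y, v y))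
    (fun t ht => (LipschitzWith.of_dist_le_mul fun p p' => by
      have h1 := hC₁' t (Ico_subset_Icc_self ht)
      have h2 := hC₂' t (Ico_subset_Icc_self ht)
      have h3 : dist p.1 p'.1 ≤ dist p p' := le_max_left _ _
      have h4 : dist p.2 p'.2 ≤ dist p p' := le_max_right _ _
      have h5 : 0 ≤ dist p p' := dist_nonneg
      rw [Prod.dist_eq, Real.dist_eq, Real.dist_eq, ← mul_sub, ← mul_sub, abs_mul, abs_mul]
      rw [Real.dist_eq] at h3 h4
      refine max_le ?_ ?_
      · calc _ ≤ C₁ * dist p p' := mul_le_mul h1 h4 (abs_nonneg _) hC₁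
          _ ≤ (C₁ + C₂) * dist p p' := by nlinarith
      · calc _ ≤ C₂ * dist p p' := mul_le_mul h2 h3 (abs_nonneg _) hC₂
          _ ≤ (C₁ + C₂) * dist p p' := by nlinarith).lipschitzOnWith)
    (fun t ht => ((hu' t ht.1).continuousWithinAt.mono Icc_subset_Ici_self).prodMk
      ((hv' t ht.1).continuousWithinAt.mono Icc_subset_Ici_self))
    (fun t ht => ((hu' t ht.1).mono (hsub t ht)).prodMk ((hv' t ht.1).mono (hsub t ht)))
    (fun _ _ => trivial)
    (H.continuous_fst.prodMk H.continuous_snd).continuousOn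
    (fun t _ => ((H.hasDerivAt_fst t).prodMk (H.hasDerivAt_snd t)).hasDerivWithinAt)
    (fun _ _ => trivial)
    (by simp [hφ0, hφ1, H.fst_zero, H.snd_zero])
  have := congrArg Prod.fst (key ⟨hx, le_rfl⟩)
  simp only [scaleDensity] at this
  rw [← this, ← mul_assoc, ← Real.exp_add]
  simp

lemma phi_eq (hq : ContDiffOn ℝ 1 q (Ici 0)) {l : ℝ} {u v : ℝ → ℝ}
    (H : IsSol (scaleDensity q) (speedDensity q) l u v) {x : ℝ} (hx : 0 ≤ x) :
    phi q l x = Real.exp (-Q (extend q) x) * u x :=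
  IsPhi.eq_of_isSol hq H (Classical.epsilon_spec (p := IsPhi q l) ⟨_, H.isPhi hq⟩) hx

lemma phi_eq_zero_iff (hq : ContDiffOn ℝ 1 q (Ici 0)) {l : ℝ} {u v : ℝ → ℝ}
    (H : IsSol (scaleDensity q) (speedDensity q) l u v) {x : ℝ} (hx : 0 ≤ x) :
    phi q l x = 0 ↔ u x = 0 := by
  rw [phi_eq hq H hx, mul_eq_zero, or_iff_right (Real.exp_ne_zero _)]

variable {θ U V : ℝ → ℝ → ℝ}

/-- Without a sign change every zero on (0, ∞) would be a local extremum of u, but zeros of u are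
simple. -/
lemma not_changesSign_phi_iff (hq : ContDiffOn ℝ 1 q (Ici 0))
    (F : SolFamily (scaleDensity q) (speedDensity q) θ U V) (l : ℝ) :
    ¬ ChangesSign (phi q l) ↔ ∀ x > 0, U l x ≠ 0 := by
  have hneg : ∀ x > 0, phi q l x < 0 ↔ U l x < 0 := fun x hx => by
    rw [phi_eq hq (F.isSol l) (le_of_lt hx)]
    simp [mul_neg_iff, Real.exp_pos, (Real.exp_pos _).not_gt]
  have hpos : ∀ x > 0, 0 < phi q l x ↔ 0 < U l x := fun x hx => by
    rw [phi_eq hq (F.isSol l) (le_of_lt hx), mul_pos_iff_of_pos_left (Real.exp_pos _)]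
  constructor
  · intro h x hx hU
    have hext : IsLocalExtr (U l) x := by
      by_cases h' : ∃ y > 0, U l y < 0
      · obtain ⟨y, hy, hyU⟩ := h'
        refine Or.inr ?_
        filter_upwards [Ioi_mem_nhds hx] with w hw
        rw [hU]
        by_contra! hwU
        exact h ⟨y, hy, w, hw, (hneg y hy).2 hyU, (hpos w hw).2 hwU⟩
      · push Not at h'
        refine Or.inl ?_
        filter_upwards [Ioi_mem_nhds hx] with w hw
        rw [hU]
        exact h' w hw
    exact mul_ne_zero (scaleDensity_pos q x).ne' (F.snd_ne_zero l x hU)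
      (hext.hasDerivAt_eq_zero ((F.isSol l).hasDerivAt_fst x))
  · rintro h ⟨x, hx, -, -, hxφ, -⟩
    exact ((hneg x hx).1 hxφ).not_gt ((F.isSol l).pos_of_ne_zero (scaleDensity_pos q) h hx)

/-! ### The spectral function and δ in terms of the system -/

lemma lintegral_phi_sq (hq : ContDiffOn ℝ 1 q (Ici 0)) {l : ℝ} {u v : ℝ → ℝ}
    (H : IsSol (scaleDensity q) (speedDensity q) l u v) {b : ℝ} (hb : 0 ≤ b) :
    ∫⁻ x in Ioo 0 b, ENNReal.ofReal (phi q l x ^ 2 * Real.exp (Q q x)) =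
      ENNReal.ofReal ((∫ x in (0 : ℝ)..b, speedDensity q x * u x ^ 2) / 2) := by
  have hu := H.continuous_fst
  have hc := continuous_speedDensity hq
  rw [← intervalIntegral.integral_div, intervalIntegral.integral_of_le hb,
    ofReal_integral_eq_lintegral_ofReal
      (((Continuous.integrableOn_Icc (by fun_prop)).mono_set Ioc_subset_Icc_self))
      (Eventually.of_forall fun x => by
        have := speedDensity_pos q x
        simp only [Pi.zero_apply]
        positivity), ← restrict_Ioo_eq_restrict_Ioc]
  refine setLIntegral_congr_fun measurableSet_Ioo fun x hx => ?_
  rw [phi_eq hq H hx.1.le, ← Q_extend q hx.1.le, speedDensity]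
  congr 1
  have : Real.exp (-Q (extend q) x) * Real.exp (Q (extend q) x) = 1 := by
    rw [← Real.exp_add]; simp
  linear_combination (Real.exp (-Q (extend q) x) * u x ^ 2) * this

lemma spectralFunction_eq_zero (hq : ContDiffOn ℝ 1 q (Ici 0))
    (F : SolFamily (scaleDensity q) (speedDensity q) θ U V) {m : ℝ}
    (hm : ∀ l < m, ∀ x > 0, U l x ≠ 0) : spectralFunction q m = 0 := by
  refine le_antisymm (iSup₂_le fun t ht => ?_) zero_le
  refine limsup_le_of_le (h := ?_)
  filter_upwards [eventually_gt_atTop 0] with b hb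
  have : IsEmpty {k : ℝ // phi q k b = 0 ∧ k < t} :=
    ⟨fun k => hm k (k.2.2.trans ht) b hb ((phi_eq_zero_iff hq (F.isSol k) hb.le).1 k.2.1)⟩
  simp [spectralFunctionOn]

/-- The value at t is a supremum over parameters below t, so the uniform lower bound is applied at
the intermediate s. -/
lemma spectralFunction_pos (hq : ContDiffOn ℝ 1 q (Ici 0))
    (F : SolFamily (scaleDensity q) (speedDensity q) θ U V) {l s t z : ℝ} (hs : 0 < s)
    (hls : l < s) (hst : s < t) (hz : 0 < z) (hlz : U l z = 0) : 0 < spectralFunction q t := by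
  obtain ⟨ε, hε, h⟩ := F.exists_spectral_lower_bound (continuous_scaleDensity hq)
    (continuous_speedDensity hq) (scaleDensity_pos q) (speedDensity_pos q) hs hls hz hlz
  refine (ENNReal.ofReal_pos.2 hε).trans_le (le_trans ?_ (le_iSup₂ (f := fun (t' : ℝ) (_ : t' < t) =>
    limsup (fun b : ℝ => spectralFunctionOn q b t') atTop) s hst))
  refine le_limsup_of_frequently_le (Eventually.frequently ?_)
  filter_upwards [eventually_gt_atTop z] with b hb
  have hb0 := hz.trans hb
  obtain ⟨K, hK, hεK⟩ := h b hb
  have hN : ∀ k, 0 < ∫ x in (0 : ℝ)..b, speedDensity q x * U k x ^ 2 := fun k =>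
    (F.isSol k).norm_pos (continuous_speedDensity hq) (speedDensity_pos q) (scaleDensity_pos q) hb0
  have hmem : ∀ k ∈ K, phi q k b = 0 ∧ k < s := fun k hk =>
    ⟨(phi_eq_zero_iff hq (F.isSol k) hb0.le).2 (hK k hk).1, (hK k hk).2⟩
  calc ENNReal.ofReal ε
      ≤ ∑ k ∈ K, ENNReal.ofReal (∫ x in (0 : ℝ)..b, speedDensity q x * U k x ^ 2)⁻¹ := by
        rw [← ENNReal.ofReal_sum_of_nonneg fun k _ => inv_nonneg.2 (hN k).le]
        exact ENNReal.ofReal_le_ofReal hεK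
    _ ≤ ∑ k ∈ K, (∫⁻ x in Ioo 0 b, ENNReal.ofReal (phi q k x ^ 2 * Real.exp (Q q x)))⁻¹ := by
        refine Finset.sum_le_sum fun k _ => ?_
        rw [lintegral_phi_sq hq (F.isSol k) hb0.le, ENNReal.ofReal_inv_of_pos (hN k)]
        -- The squared norm of φ_k is half of that of u_k, so its inverse is larger.
        exact ENNReal.inv_le_inv.2 (ENNReal.ofReal_le_ofReal (half_le_self (hN k).le))
    _ = ∑ k ∈ K.subtype fun k => phi q k b = 0 ∧ k < s,
          (∫⁻ x in Ioo 0 b, ENNReal.ofReal (phi q k x ^ 2 * Real.exp (Q q x)))⁻¹ :=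
        (Finset.sum_subtype_of_mem _ hmem).symm
    _ ≤ spectralFunctionOn q b s := ENNReal.sum_le_tsum _

lemma scale_eq (q : ℝ → ℝ) {x : ℝ} (hx : 0 ≤ x) :
    scale q x = ∫ t in (0 : ℝ)..x, scaleDensity q t := by
  refine intervalIntegral.integral_congr fun t ht => ?_
  rw [uIcc_of_le hx] at ht
  simp only [scaleDensity, Q_extend q ht.1]

lemma lintegral_speed_eq (q : ℝ → ℝ) {x : ℝ} (hx : 0 ≤ x) :
    ∫⁻ y in Ioi x, ENNReal.ofReal (2 * Real.exp (-Q q y)) =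
      ∫⁻ y in Ioi x, ENNReal.ofReal (speedDensity q y) := by
  refine setLIntegral_congr_fun measurableSet_Ioi fun y hy => ?_
  simp only [speedDensity, Q_extend q (hx.trans (le_of_lt hy))]

lemma exists_pos_parameter_of_delta_lt_top (hq : ContDiffOn ℝ 1 q (Ici 0))
    (F : SolFamily (scaleDensity q) (speedDensity q) θ U V) (hδ : delta q < ⊤) :
    ∃ l > 0, ∀ x > 0, U l x ≠ 0 := by
  have ha := continuous_scaleDensity hq
  have hc := continuous_speedDensity hq
  have hΛpos : ∀ x > 0, 0 < ∫ t in (0 : ℝ)..x, scaleDensity q t := fun x hx =>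
    integral_zero_pos ha (scaleDensity_pos q) hx
  have hle : ∀ x > 0, ENNReal.ofReal (∫ t in (0 : ℝ)..x, scaleDensity q t) *
      ∫⁻ y in Ioi x, ENNReal.ofReal (speedDensity q y) ≤ delta q := by
    intro x hx
    rw [← scale_eq q (le_of_lt hx), ← lintegral_speed_eq q (le_of_lt hx)]
    exact le_iSup₂ (f := fun (x : ℝ) (_ : 0 < x) => ENNReal.ofReal (scale q x) *
      ∫⁻ y in Ioi x, ENNReal.ofReal (2 * Real.exp (-Q q y))) x hx
  -- An infinite tail would already make the product at x = 1 infinite, since Λ(1) > 0.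
  have hint1 : IntegrableOn (speedDensity q) (Ioi 1) := by
    refine ⟨hc.aestronglyMeasurable, ?_⟩
    rw [hasFiniteIntegral_iff_ofReal (Eventually.of_forall fun x => (speedDensity_pos q x).le)]
    by_contra! h
    have h1 := hle 1 one_pos
    rw [top_le_iff.1 h, ENNReal.mul_top (ENNReal.ofReal_pos.2 (hΛpos 1 one_pos)).ne'] at h1
    exact hδ.not_ge h1
  have hint : IntegrableOn (speedDensity q) (Ioi 0) := by
    rw [← Ioc_union_Ioi_eq_Ioi zero_le_one]
    exact (hc.integrableOn_Icc.mono_set Ioc_subset_Icc_self).union hint1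
  -- The tail of the speed measure, written as total mass minus an integral so that it is
  -- differentiable on all of ℝ.
  set M : ℝ → ℝ := fun x => (∫ t in Ioi 0, speedDensity q t) - ∫ t in (0 : ℝ)..x, speedDensity q t
  have hMeq : ∀ x > 0, M x = ∫ t in Ioi x, speedDensity q t := by
    intro x hx
    have := intervalIntegral.integral_interval_add_Ioi hint (hint.mono_set (Ioi_subset_Ioi hx.le))
    simp only [M]
    linarith
  have hM0 : ∀ x > 0, 0 ≤ M x := fun x hx => by
    rw [hMeq x hx]
    exact integral_nonneg fun t => (speedDensity_pos q t).le
  -- With D = δ + 1 > 0 this is half of the threshold 1 / (4D).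
  refine ⟨1 / (8 * ((delta q).toReal + 1)), by positivity,
    F.ne_zero_of_mul_le ha hc (scaleDensity_pos q) (speedDensity_pos q) (M := M)
      (D := (delta q).toReal + 1) (hasDerivAt_integral_zero ha)
      intervalIntegral.integral_same hΛpos
      (fun x => by simpa using (hasDerivAt_integral_zero hc x).const_sub _) hM0 (by positivity)
      (fun x hx => ?_) ?_⟩
  · have h1 := hle x hx
    rw [← ofReal_integral_eq_lintegral_ofReal (hint.mono_set (Ioi_subset_Ioi (le_of_lt hx)))
      (Eventually.of_forall fun x => (speedDensity_pos q x).le), ← hMeq x hx,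
      ← ENNReal.ofReal_mul (hΛpos x hx).le] at h1
    have := (ENNReal.ofReal_le_iff_le_toReal hδ.ne).1 h1
    linarith
  · exact one_div_lt_one_div_of_lt (by positivity) (by
      have : 0 ≤ (delta q).toReal := ENNReal.toReal_nonneg
      linarith)

lemma delta_lt_top (hq : ContDiffOn ℝ 1 q (Ici 0)) (h1 : HypH1 q)
    (F : SolFamily (scaleDensity q) (speedDensity q) θ U V) {l : ℝ} (hl : 0 < l)
    (hne : ∀ x > 0, U l x ≠ 0) : delta q < ⊤ := by
  have ha := continuous_scaleDensity hq
  have hc := continuous_speedDensity hq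
  have hΛpos : ∀ x > 0, 0 < ∫ t in (0 : ℝ)..x, scaleDensity q t := fun x hx =>
    integral_zero_pos ha (scaleDensity_pos q) hx
  have hΛtop : Tendsto (fun x => ∫ t in (0 : ℝ)..x, scaleDensity q t) atTop atTop :=
    h1.congr' (by filter_upwards [eventually_ge_atTop 0] with x hx using scale_eq q hx)
  refine lt_of_le_of_lt (iSup₂_le fun x hx => ?_) (ENNReal.ofReal_lt_top (r := 1 / l))
  rw [scale_eq q hx.le, lintegral_speed_eq q hx.le]
  -- The estimate holds on bounded intervals (x, y]; letting y → ∞ gives it for the whole tail.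
  have hlim : Tendsto (fun y => ∫⁻ t in Ioc x y, ENNReal.ofReal (speedDensity q t)) atTop
      (𝓝 (∫⁻ t in Ioi x, ENNReal.ofReal (speedDensity q t))) :=
    AECover.lintegral_tendsto_of_countably_generated (φ := fun y => Iic y) (aecover_Iic tendsto_id)
      (μ := volume.restrict (Ioi x)) hc.measurable.ennreal_ofReal.aemeasurable |>.congr fun y => by
        rw [Measure.restrict_restrict measurableSet_Iic, inter_comm, Ioi_inter_Iic]
  refine le_of_tendsto (ENNReal.Tendsto.const_mul hlim (Or.inr ENNReal.ofReal_ne_top)) ?_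
  filter_upwards [eventually_gt_atTop x] with y hy
  rw [← ofReal_integral_eq_lintegral_ofReal (hc.integrableOn_Icc.mono_set Ioc_subset_Icc_self)
    (Eventually.of_forall fun x => (speedDensity_pos q x).le),
    ← ENNReal.ofReal_mul (hΛpos x hx).le, ← intervalIntegral.integral_of_le hy.le]
  refine ENNReal.ofReal_le_ofReal ?_
  have := F.mul_integral_le (scaleDensity_pos q) (speedDensity_pos q) (hasDerivAt_integral_zero ha)
    intervalIntegral.integral_same hΛpos hΛtop (hasDerivAt_integral_zero hc) hl hne hx hy
  rw [intervalIntegral.integral_interval_sub_left (hc.intervalIntegrable _ _)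
    (hc.intervalIntegrable _ _)] at this
  rw [le_div_iff₀ hl]
  linarith

end

end QSD

end

/-! ### Conclusion: the common threshold m -/

theorem lemma3p4 (q : ℝ → ℝ) (hq : ContDiffOn ℝ 1 q (Set.Ici 0)) (hH : QSD.HypH q) :
    IsLeast {l : ℝ | QSD.IsPointOfIncrease (QSD.spectralFunction q) l} (QSD.lambdaC q) ∧
    IsLUB {l : ℝ | ¬ QSD.ChangesSign (QSD.phi q l)} (QSD.lambdaC q) ∧
    (0 < QSD.lambdaC q ↔ QSD.delta q < ⊤) := by
  have ha := QSD.continuous_scaleDensity hq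
  have hc := QSD.continuous_speedDensity hq
  obtain ⟨θ, U, V, F⟩ := QSD.exists_solFamily ha hc
  have hset : {l : ℝ | ¬ QSD.ChangesSign (QSD.phi q l)} = {l | ∀ x > 0, U l x ≠ 0} :=
    Set.ext fun l => QSD.not_changesSign_phi_iff hq F l
  have hbdd := F.bddAbove_parameters ha hc (QSD.scaleDensity_pos q) (QSD.speedDensity_pos q)
  have h0 : (0 : ℝ) ∈ {l | ∀ x > 0, U l x ≠ 0} :=
    fun x hx => (F.pos_of_parameter_zero (QSD.scaleDensity_pos q) hx).ne'
  have hlub := isLUB_csSup ⟨0, h0⟩ hbdd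
  set m := sSup {l | ∀ x > 0, U l x ≠ 0}
  have hm0 : 0 ≤ m := hlub.1 h0
  have hbelow : ∀ l < m, ∀ x > 0, U l x ≠ 0 := by
    intro l hl
    obtain ⟨l', hl', hll', -⟩ := hlub.exists_between hl
    exact F.ne_zero_of_lt ha hc (QSD.scaleDensity_pos q) (QSD.speedDensity_pos q) hll' hl'
  have hzero : ∀ t ≤ m, QSD.spectralFunction q t = 0 := fun t ht =>
    QSD.spectralFunction_eq_zero hq F fun l hl => hbelow l (hl.trans_le ht)
  have hpos : ∀ t, m < t → 0 < QSD.spectralFunction q t := by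
    intro t ht
    obtain ⟨s, hms, hst⟩ := exists_between ht
    obtain ⟨l, hml, hls⟩ := exists_between hms
    have hl : ¬ ∀ x > 0, U l x ≠ 0 := fun h => (hlub.1 h).not_gt hml
    push Not at hl
    obtain ⟨z, hz, hlz⟩ := hl
    exact QSD.spectralFunction_pos hq F (hm0.trans_lt hms) hls hst hz hlz
  have hleast : IsLeast {l : ℝ | QSD.IsPointOfIncrease (QSD.spectralFunction q) l} m := by
    refine ⟨fun ε hε => ?_, fun l hl => ?_⟩
    · rw [hzero (m - ε) (by linarith)]
      exact hpos _ (by linarith)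
    · by_contra! h
      -- For l < m the choice ε = m - l makes the right endpoint exactly m, where the spectral
      -- function is still 0.
      have h1 := hl (m - l) (sub_pos.2 h)
      rw [add_sub_cancel, hzero m le_rfl] at h1
      exact not_lt_zero h1
  have hlam : QSD.lambdaC q = m := hleast.csInf_eq
  rw [hlam, hset]
  refine ⟨hleast, hlub, fun hm => ?_, fun hδ => ?_⟩
  · exact QSD.delta_lt_top hq hH.1 F (half_pos hm) (hbelow _ (half_lt_self hm))
  · obtain ⟨l, hl, hne⟩ := QSD.exists_pos_parameter_of_delta_lt_top hq F hδ
    exact lt_of_lt_of_le hl (hlub.1 hne)
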